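/- All graphs are finite, undirected, without loops or multiple edges. For $r\ge 1$, a connected graph $G$ is \emph{$r$-connected} if it has at least $r+1$ vertices and every set $S$ of vertices such that $G-S$ is disconnected has $|S|\ge r$. A graph is \emph{chordal} if it contains no induced cycle of length greater than $3$. A \emph{$k$-coloring} of $G=(V,E)$ is a map $\alpha:V\to\{1,\dots,k\}$ with $\alpha(u)\neq\alpha(v)$ for every edge $uv$. The \emph{$k$-color graph} $\mathcal C_k(G)$ has as nodes all $k$-colorings of $G$, two of them being adjacent if and only if they differ on exactly one vertex. Let $T\subseteq V$, and label each node $\gamma$ of $\mathcal C_k(G)$ by its restriction $\gamma|_T$. A \emph{label component} is a maximal set of nodes that all have the same label and that induce a connected (nonempty) subgraph of $\mathcal C_k(G)$. The \emph{contracted solution graph} $\mathcal C^c_k(G,T)$ is the labeled graph whose nodes are the label components; two distinct label components $x,y$ are adjacent if and only if there are $\alpha\in x$ and $\beta\in y$ that are adjacent in $\mathcal C_k(G)$; and the label $\ell(x)$ is the common label of all elements of $x$. For $1\le m\le k$, a labeled graph $(H,\ell)$ is an \emph{$(m,k)$-color-complete graph} if there is a set $T$ with $|T|=m$ such that every label $\ell(v)$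 is a $k$-coloring of the complete graph on the vertex set $T$, every such $k$-coloring is the label of exactly one vertex of $H$, and two vertices of $H$ are adjacent if and only if their labels differ on exactly one element of $T$. A labeled graph $(H,\ell)$ has the \emph{injective neighborhood property} if $\ell(v)\neq\ell(w)$ whenever $v\neq w$ are neighbors of a common vertex of $H$. \textbf{Theorem.} Let $k\ge 3$. Let $G=(V,E)$ be a $(k-2)$-connected $k$-colorable chordal graph, and let $T\subseteq V$ be a clique of $G$ with $m=|T|\ge k-2$. Then $\mathcal C^c_k(G,T)$ is an $(m,k)$-color-complete graph, or it is a forest that satisfies the injective neighborhood property. -/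

import Mathlib

open SimpleGraph

namespace ContractedSolutionGraph

/-! ### Graph classes -/

/-- `G` is `r`-connected (used for `r ≥ 1`): it is connected, has at least `r + 1` vertices, and
every vertex cut, that is, every set `S` of vertices such that `G - S` is disconnected, has at
least `r` elements. -/
structure IsVertexConnected {V : Type*} [Fintype V] (G : SimpleGraph V) (r : ℕ) : Prop where
  connected : G.Connected
  card_lt : r + 1 ≤ Fintype.card V
  le_card_of_cut : ∀ S : Finset V, ¬ (G.induce {v | v ∉ S}).Preconnected → r ≤ S.card

/-- A graph is chordal if it contains no induced cycle of length greater than `3`. -/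
def IsChordal {V : Type*} (G : SimpleGraph V) : Prop :=
  ∀ n : ℕ, 3 < n → ¬ (cycleGraph n).IsIndContained G

/-! ### The contracted solution graph of a solution graph `S` with node labels `p` -/

section General

variable {N X : Type*} (S : SimpleGraph N) (p : N → X)

/-- A label component: a maximal set of nodes that all have the same label and that induce a
connected (in particular nonempty) subgraph of the solution graph. -/
def IsLabelComponent (C : Set N) : Prop :=
  Maximal (fun D : Set N => (∀ a ∈ D, ∀ b ∈ D, p a = p b) ∧ (S.induce D).Connected) C

/-- The nodes of the contracted solution graph: the label components. -/
abbrev LabelComponent : Type _ := {C : Set N // IsLabelComponent S p C}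

/-- The contracted solution graph: two distinct label components are adjacent iff they contain
solutions that are adjacent in the solution graph. -/
def contractedGraph : SimpleGraph (LabelComponent S p) where
  Adj x y := x ≠ y ∧ ∃ a ∈ x.1, ∃ b ∈ y.1, S.Adj a b
  symm := ⟨fun _ _ ⟨hne, a, ha, b, hb, h⟩ => ⟨hne.symm, b, hb, a, ha, h.symm⟩⟩
  loopless := ⟨fun _ h => h.1 rfl⟩

theorem LabelComponent.nonempty (x : LabelComponent S p) : x.1.Nonempty :=
  Set.nonempty_coe_sort.mp x.2.prop.2.nonempty

/-- The label function of the contracted solution graph: the common label of all solutions in a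
label component (see `contractedLabel_eq`). -/
noncomputable def contractedLabel (x : LabelComponent S p) : X :=
  p (LabelComponent.nonempty S p x).some

theorem contractedLabel_eq (x : LabelComponent S p) {a : N} (ha : a ∈ x.1) :
    contractedLabel S p x = p a :=
  x.2.prop.1 _ (LabelComponent.nonempty S p x).some_mem _ ha

/-- The label components partition the node set of the solution graph. -/
theorem existsUnique_labelComponent (a : N) : ∃! x : LabelComponent S p, a ∈ x.1 := by
  let P : Set N → Prop := fun D => (∀ a ∈ D, ∀ b ∈ D, p a = p b) ∧ (S.induce D).Connected
  have hP : ∀ 𝒟 : Set (Set N), 𝒟.Nonempty → (∀ D ∈ 𝒟, a ∈ D ∧ P D) → P (⋃₀ 𝒟) := by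
    intro 𝒟 hne h𝒟
    refine ⟨?_, ?_⟩
    · rintro b ⟨B, hB, hb⟩ c ⟨C, hC, hc⟩
      exact ((h𝒟 B hB).2.1 b hb a (h𝒟 B hB).1).trans ((h𝒟 C hC).2.1 a (h𝒟 C hC).1 c hc)
    · exact induce_sUnion_connected_of_pairwise_not_disjoint hne
        (fun {s t} hs ht => ⟨a, (h𝒟 s hs).1, (h𝒟 t ht).1⟩) (fun {s} hs => (h𝒟 s hs).2.2)
  have h1 : P {a} := by
    refine ⟨?_, ?_⟩
    · rintro b rfl c rfl
      rfl
    · rw [connected_iff]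
      exact ⟨.of_subsingleton, inferInstance⟩
  have hM : IsLabelComponent S p (⋃₀ {D | a ∈ D ∧ P D}) := by
    refine ⟨hP _ ⟨{a}, rfl, h1⟩ fun D hD => hD, ?_⟩
    intro D hD hle
    have haD : a ∈ D := hle ⟨{a}, ⟨rfl, h1⟩, rfl⟩
    exact Set.subset_sUnion_of_mem (show D ∈ {D | a ∈ D ∧ P D} from ⟨haD, hD⟩)
  refine ⟨⟨_, hM⟩, ⟨{a}, ⟨rfl, h1⟩, rfl⟩, ?_⟩
  rintro ⟨C, hC⟩ haC
  apply Subtype.ext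
  exact hC.eq_of_subset hM.prop
    (Set.subset_sUnion_of_mem (show C ∈ {D | a ∈ D ∧ P D} from ⟨haC, hC.prop⟩))

end General

/-! ### Colorings -/

section Coloring

variable {V : Type*} (G : SimpleGraph V) (k : ℕ)

/-- The `k`-color graph: its nodes are the (proper) `k`-colorings of `G`, and two colorings are
adjacent iff they differ on exactly one vertex. -/
def colorGraph : SimpleGraph (G.Coloring (Fin k)) where
  Adj α β := ∃! v : V, α v ≠ β v
  symm := ⟨fun _ _ ⟨v, hv, huniq⟩ => ⟨v, Ne.symm hv, fun w hw => huniq w (Ne.symm hw)⟩⟩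
  loopless := ⟨fun _ ⟨_, hv, _⟩ => hv rfl⟩

variable (T : Finset V)

/-- The terminal projection: a `k`-coloring of `G` is labelled by its restriction to `T`. -/
def restrictTo (γ : G.Coloring (Fin k)) : T → Fin k := fun t => γ t

/-- The nodes of the contracted solution graph of the `k`-colorings of `G` with terminal set
`T`. -/
abbrev CSGNode : Type _ := LabelComponent (colorGraph G k) (restrictTo G k T)

/-- The contracted solution graph of the `k`-colorings of `G` with terminal set `T`. -/
def csg : SimpleGraph (CSGNode G k T) := contractedGraph (colorGraph G k) (restrictTo G k T)

/-- The label function of the contracted solution graph `csg G k T`. -/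
noncomputable def csgLabel : CSGNode G k T → T → Fin k :=
  contractedLabel (colorGraph G k) (restrictTo G k T)

end Coloring

/-! ### Two properties of labelled graphs -/

/-- The labelled graph `H, ℓ`, whose labels are color assignments of `ι`, is an
`(m, k)`-color-complete graph. -/
structure IsColorComplete {W ι : Type*} [Fintype ι] (m k : ℕ)
    (H : SimpleGraph W) (ℓ : W → ι → Fin k) : Prop where
  one_le : 1 ≤ m
  le : m ≤ k
  card_eq : Fintype.card ι = m
  /-- Every label is a `k`-coloring of the complete graph on `ι`. -/
  label_coloring : ∀ x : W, ∃ γ : (⊤ : SimpleGraph ι).Coloring (Fin k), ℓ x = ⇑γ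
  /-- Every such coloring is the label of exactly one node. -/
  existsUnique_label : ∀ γ : (⊤ : SimpleGraph ι).Coloring (Fin k), ∃! x : W, ℓ x = ⇑γ
  /-- Two nodes are adjacent iff their labels differ on exactly one element of `ι`. -/
  adj_iff : ∀ x y : W, H.Adj x y ↔ ∃! t : ι, ℓ x t ≠ ℓ y t

/-- The injective neighborhood property: distinct neighbors of any node have distinct labels. -/
def InjectiveNeighborhood {W X : Type*} (H : SimpleGraph W) (ℓ : W → X) : Prop :=
  ∀ u v w : W, H.Adj u v → H.Adj u w → v ≠ w → ℓ v ≠ ℓ w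

end ContractedSolutionGraph

/-!
The theorem is proved by decomposing the chordal graph `G` along the clique `T`, and following the
contracted solution graph through the decomposition. Instead of a color-complete contracted
solution graph, the induction carries the equivalent and more convenient property
`IsUnobstructed`: labels determine nodes, all labels occur, and all recolorings of `T` are possible.

Let `A` be the current set of vertices and `T ⊆ A` a clique of size at least `k - 2`. If `A = T`,
there is no obstruction. If `T` lies in a clique of size `k`, no vertex of `T` can ever be recolored,
so the contracted solution graph has no edges (`isForestINP_of_subset_clique`). Otherwise one of
three steps reduces the problem (`outcome_within`).

* If `T` separates `A`, the graph is glued from two smaller ones along `T`. A node is determined by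
  its two projections (`node_eq_of_res_eq`), which gives the injective neighborhood property; this
  property makes each projection locally injective, and a graph with a locally injective map to a
  forest is a forest (`isAcyclic_of_locallyInjective`).
* If some `u` in `T` has no neighbor in `A` outside `T`, then connectivity forces `T \ {u}` to have
  exactly `k - 2` elements. Adding `u` to the graph and to the terminals replaces each node by two
  adjacent ones, for the two colors that are left for `u`, and lifts each edge exactly once, since
  just one color is missing on `T \ {u}` both before and after the recoloring of one of its vertices
  (`introduce_outcome`, `isAcyclic_of_expansion`).
* In the remaining case `A \ T` is connected and meets the neighborhood of every vertex of `T`, and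
  chordality provides a vertex `v` of `A \ T` adjacent to all of `T`
  (`IsChordal.exists_adj_clique`). With `v` added to `T` there are fewer vertices left outside; to
  forget `v` again means to contract the edges that recolor `v`, which form a matching
  (`forget_outcome`, `isAcyclic_of_contraction`).

All graphs in the induction live on the vertex set of `G`: the part on `A` is the spanning subgraph
`within G A`, with the vertices outside `A` isolated. Isolated vertices that are not terminals do
not affect the contracted solution graph.
-/

namespace ContractedSolutionGraph

/-! ### Acyclicity along maps of graphs -/

section Acyclic

variable {W W₀ : Type*} {H : SimpleGraph W} {H₀ : SimpleGraph W₀} {f : W → W₀}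

theorem isChain_edges_map (F : H →g H₀)
    (hinj : ∀ x y z, H.Adj x y → H.Adj x z → F y = F z → y = z) {u v : W} (p : H.Walk u v)
    (hp : p.edges.IsChain (· ≠ ·)) : (p.map F).edges.IsChain (· ≠ ·) := by
  induction p with
  | nil => simp
  | cons h p ih =>
    cases p with
    | nil => simp
    | cons h' p =>
      simp only [Walk.edges_cons, Walk.map_cons, List.isChain_cons_cons] at hp ih ⊢
      refine ⟨fun he => hp.1 ?_, ih hp.2⟩
      rw [Sym2.eq_swap, Sym2.congr_right] at he
      rw [Sym2.eq_swap, Sym2.congr_right]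
      exact hinj _ _ _ h.symm h' he

/-- A cycle would be mapped to a closed walk without backtracking, and in a forest such a walk
is trivial. -/
theorem isAcyclic_of_locallyInjective (hadj : ∀ x y, H.Adj x y → H₀.Adj (f x) (f y))
    (hinj : ∀ x y z, H.Adj x y → H.Adj x z → f y = f z → y = z) (h₀ : H₀.IsAcyclic) :
    H.IsAcyclic := by
  intro v c hc
  let F : H →g H₀ := ⟨f, fun {a b} h => hadj a b h⟩
  have hpath : (c.map F).IsPath := (h₀.isPath_iff_isChain _).2
    (isChain_edges_map F hinj c (hc.isTrail.edges_nodup.isChain))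
  have h1 := Walk.length_eq_zero_iff.2 (Walk.isPath_iff_nil.1 hpath)
  have h2 := hc.three_le_length
  rw [Walk.length_map] at h1
  omega

/-- Blowing up vertices of a forest into edges, with each edge of the forest lifted at most once,
produces a forest. -/
theorem isAcyclic_of_expansion
    (hadj : ∀ x y, H.Adj x y → f x = f y ∨ H₀.Adj (f x) (f y))
    (hlift : ∀ x y x' y', H.Adj x y → H.Adj x' y' → f x ≠ f y → f x = f x' → f y = f y' → x = x')
    (hfib : ∀ x y z, H.Adj x y → f x = f y → f z = f x → z = x ∨ z = y)
    (h₀ : H₀.IsAcyclic) : H.IsAcyclic := by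
  rw [isAcyclic_iff_forall_adj_isBridge] at h₀ ⊢
  -- Two adjacent vertices with distinct images are the only lift of the edge between the images.
  have key : ∀ x y z z', H.Adj x y → f x ≠ f y → H.Adj z z' → s(z, z') ≠ s(x, y) →
      (H₀.deleteEdges {s(f x, f y)}).Reachable (f z) (f z') := by
    intro x y z z' hxy hne hz hzz
    rcases hadj z z' hz with h | h
    · rw [h]
    · refine Adj.reachable ?_
      rw [deleteEdges_adj]
      refine ⟨h, fun he => hzz ?_⟩
      rw [Set.mem_singleton_iff, Sym2.eq_iff] at he
      rcases he with ⟨h1, h2⟩ | ⟨h1, h2⟩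
      · rw [hlift x y z z' hxy hz hne h1.symm h2.symm,
          hlift y x z' z hxy.symm hz.symm hne.symm h2.symm h1.symm]
      · rw [hlift x y z' z hxy hz.symm hne h2.symm h1.symm,
          hlift y x z z' hxy.symm hz hne.symm h1.symm h2.symm, Sym2.eq_swap]
  intro x y hxy
  rw [isBridge_iff]
  rintro ⟨p⟩
  by_cases hf : f x = f y
  · -- All that a walk starting at `x` can reach without the edge `xy` lies, up to `x` itself,
    -- above the branches at `f x` whose first edge is lifted to an edge at `x`.
    suffices h : ∀ z, (H.deleteEdges {s(x, y)}).Reachable x z → z = x ∨ ∃ b, H.Adj x b ∧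
        f b ≠ f x ∧ (H₀.deleteEdges {s(f x, f b)}).Reachable (f b) (f z) by
      rcases h y ⟨p⟩ with h | ⟨b, hb, hne, hr⟩
      · exact hxy.ne h.symm
      · have hb' := (hadj x b hb).resolve_left hne.symm
        rw [← hf] at hr
        exact isBridge_iff.1 (h₀ hb') hr.symm
    intro z hz
    rw [reachable_iff_reflTransGen] at hz
    induction hz with
    | refl => exact Or.inl rfl
    | @tail z z' _ hzz ih =>
      rw [deleteEdges_adj, Set.mem_singleton_iff] at hzz
      obtain ⟨hzz, hne⟩ := hzz
      rcases ih with rfl | ⟨b, hb, hbne, hr⟩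
      · by_cases hfz : f z' = f z
        · rcases hfib z y z' hxy hf hfz with h | h
          · exact Or.inl h
          · exact absurd (by rw [h]) hne
        · exact Or.inr ⟨z', hzz, hfz, Reachable.refl _⟩
      · by_cases he : s(z, z') = s(x, b)
        · rw [Sym2.eq_iff] at he
          rcases he with ⟨rfl, rfl⟩ | ⟨rfl, rfl⟩
          · exact Or.inr ⟨z', hb, hbne, Reachable.refl _⟩
          · exact Or.inl rfl
        · exact Or.inr ⟨b, hb, hbne, hr.trans (key x b z z' hb hbne.symm hzz he)⟩
  · refine isBridge_iff.1 (h₀ ((hadj x y hxy).resolve_left hf)) ?_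
    have : ∀ w, (H.deleteEdges {s(x, y)}).Reachable x w →
        (H₀.deleteEdges {s(f x, f y)}).Reachable (f x) (f w) := by
      intro w hw
      rw [reachable_iff_reflTransGen] at hw
      induction hw with
      | refl => rfl
      | @tail z z' _ hzz ih =>
        rw [deleteEdges_adj, Set.mem_singleton_iff] at hzz
        exact ih.trans (key x y z z' hxy hf hzz.1 hzz.2)
    exact this y ⟨p⟩

/-- Contracting connected sets of vertices turns a forest into a forest. -/
theorem isAcyclic_of_contraction
    (hlift : ∀ p q, H₀.Adj p q → ∃ x y, f x = p ∧ f y = q ∧ H.Adj x y)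
    (hfib : ∀ x y, f x = f y → Relation.ReflTransGen (fun a b => H.Adj a b ∧ f a = f b) x y)
    (h : H.IsAcyclic) : H₀.IsAcyclic := by
  rw [isAcyclic_iff_forall_adj_isBridge] at h ⊢
  intro p q hpq
  obtain ⟨x, y, rfl, rfl, hxy⟩ := hlift p q hpq
  rw [isBridge_iff]
  intro hr
  refine isBridge_iff.1 (h hxy) ?_
  have hfib' : ∀ z z', f z = f z' → (H.deleteEdges {s(x, y)}).Reachable z z' := by
    intro z z' hz
    have := hfib z z' hz
    rw [reachable_iff_reflTransGen]
    refine Relation.ReflTransGen.mono (fun a b hab => ?_) _ _ this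
    rw [deleteEdges_adj, Set.mem_singleton_iff, Sym2.eq_iff]
    refine ⟨hab.1, ?_⟩
    rintro (⟨rfl, rfl⟩ | ⟨rfl, rfl⟩)
    · exact hpq.ne hab.2
    · exact hpq.ne hab.2.symm
  have hwalk : ∀ r, (H₀.deleteEdges {s(f x, f y)}).Reachable (f x) r →
      ∀ z, f z = r → (H.deleteEdges {s(x, y)}).Reachable x z := by
    intro r hr
    rw [reachable_iff_reflTransGen] at hr
    induction hr with
    | refl => exact fun z hz => hfib' _ _ hz.symm
    | @tail r r' _ hrr ih =>
      intro z hz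
      rw [deleteEdges_adj, Set.mem_singleton_iff] at hrr
      obtain ⟨a, b, rfl, rfl, hab⟩ := hlift r r' hrr.1
      refine ((ih a rfl).trans (Adj.reachable ?_)).trans (hfib' _ _ hz.symm)
      rw [deleteEdges_adj, Set.mem_singleton_iff]
      refine ⟨hab, fun he => hrr.2 ?_⟩
      rw [← Sym2.map_mk, ← Sym2.map_mk, he]
  exact hwalk _ hr y rfl

end Acyclic

/-! ### Restricting the edges to a set of active vertices -/

section Within

variable {V : Type*} (G : SimpleGraph V)

/-- The spanning subgraph of `G` consisting of the edges with both ends in `A`. The vertices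
outside `A` stay as isolated vertices, so that all these graphs share their vertex set. -/
def within (A : Set V) : SimpleGraph V where
  Adj x y := G.Adj x y ∧ x ∈ A ∧ y ∈ A
  symm := ⟨fun _ _ ⟨h, hx, hy⟩ => ⟨h.symm, hy, hx⟩⟩
  loopless := ⟨fun _ h => h.1.ne rfl⟩

variable {G}

theorem within_univ : within G Set.univ = G := by
  ext x y
  simp [within]

theorem mem_of_within_reachable {A : Set V} {x y : V} (h : (within G A).Reachable x y)
    (hx : x ∈ A) : y ∈ A := by
  rw [reachable_iff_reflTransGen] at h
  induction h with
  | refl => exact hx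
  | tail _ h _ => exact h.2.2

theorem within_reachable_of_preconnected {A : Set V} (h : (G.induce A).Preconnected) {x y : V}
    (hx : x ∈ A) (hy : y ∈ A) : (within G A).Reachable x y :=
  (h ⟨x, hx⟩ ⟨y, hy⟩).map
    (⟨Subtype.val, fun {a b} hab => ⟨hab, a.2, b.2⟩⟩ : G.induce A →g within G A)

end Within

/-! ### Chordal graphs -/

section Chordal

variable {V : Type*} {G : SimpleGraph V}

theorem not_isChordal_of_cycle (q : ℕ → V) (n : ℕ) (hn : 3 < n)
    (hinj : ∀ i j, i < j → j < n → q i ≠ q j)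
    (hadj : ∀ i j, i < j → j < n → (G.Adj (q i) (q j) ↔ j = i + 1 ∨ i = 0 ∧ j = n - 1)) :
    ¬ IsChordal G := by
  intro hG
  refine hG n hn ⟨⟨⟨fun i => q i, ?_⟩, ?_⟩⟩
  · intro i j hij
    by_contra hne
    rcases lt_or_gt_of_ne (Fin.val_ne_of_ne hne) with h | h
    · exact hinj i j h j.2 hij
    · exact hinj j i h i.2 hij.symm
  · have hcyc : ∀ i j : Fin n, i < j → ((cycleGraph n).Adj i j ↔
        (j : ℕ) = i + 1 ∨ (i : ℕ) = 0 ∧ (j : ℕ) = n - 1) := by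
      intro i j hij
      have hi := i.2
      have hj := j.2
      rw [Fin.lt_def] at hij
      rw [cycleGraph_adj', Fin.sub_def, Fin.sub_def]
      simp only
      rw [Nat.mod_eq_of_lt (show n - j + i < n by omega),
        show n - (i : ℕ) + j = (j - i) + n by omega, Nat.add_mod_right,
        Nat.mod_eq_of_lt (by omega)]
      omega
    intro i j
    change G.Adj (q i) (q j) ↔ (cycleGraph n).Adj i j
    rcases lt_trichotomy i j with h | rfl | h
    · rw [hcyc i j h, hadj i j h j.2]
    · simp
    · rw [adj_comm, hadj j i h i.2, adj_comm, hcyc j i h]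

/-- In a chordal graph, a connected set `B` containing a neighbour of every vertex of a clique `T`
contains a vertex adjacent to all of `T`. Indeed, for a vertex `v` of `B` with the most neighbours
in `T` and some `t` in `T` not adjacent to `v`, a shortest path in `B` from `v` to a neighbour of
`t` closes up, through `t` and another vertex of `T`, to an induced cycle. -/
theorem IsChordal.exists_adj_clique (hG : IsChordal G) (T : Finset V)
    (hT : G.IsClique (T : Set V)) (B : Set V) (hB : B.Nonempty) (hTB : ∀ t ∈ T, t ∉ B)
    (hconn : ∀ x ∈ B, ∀ y ∈ B, (within G B).Reachable x y)
    (hnbr : ∀ t ∈ T, ∃ b ∈ B, G.Adj t b) : ∃ v ∈ B, ∀ t ∈ T, G.Adj v t := by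
  classical
  obtain ⟨v, hvB, hvmax⟩ : ∃ v ∈ B, ∀ b ∈ B,
      (T.filter (G.Adj b)).card ≤ (T.filter (G.Adj v)).card := by
    obtain ⟨b₀, hb₀⟩ := hB
    have hfin : (Set.range fun b : B => (T.filter (G.Adj b)).card).Finite :=
      (Set.finite_Iic T.card).subset (by
        rintro _ ⟨b, rfl⟩
        exact Finset.card_filter_le _ _)
    obtain ⟨_, ⟨⟨v, hv⟩, rfl⟩, hmax⟩ := hfin.exists_maximal ⟨_, ⟨⟨b₀, hb₀⟩, rfl⟩⟩
    refine ⟨v, hv, fun b hb => ?_⟩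
    by_contra hlt
    exact hlt (hmax ⟨⟨b, hb⟩, rfl⟩ (not_le.1 hlt).le)
  refine ⟨v, hvB, ?_⟩
  by_contra hnot
  push Not at hnot
  obtain ⟨t, htT, hvt⟩ := hnot
  let D := within G B
  -- `b` is a neighbour of `t` in `B` closest to `v`.
  have hex : ∃ d, ∃ b ∈ B, G.Adj t b ∧ D.dist v b = d := by
    obtain ⟨b, hb, htb⟩ := hnbr t htT
    exact ⟨_, b, hb, htb, rfl⟩
  obtain ⟨b, hbB, htb, hbd⟩ := Nat.find_spec hex
  have hmin : ∀ c ∈ B, G.Adj t c → D.dist v b ≤ D.dist v c := fun c hc htc => by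
    rw [hbd]
    exact Nat.find_min' hex ⟨c, hc, htc, rfl⟩
  obtain ⟨s, hsT, hvs, hbs⟩ : ∃ s ∈ T, G.Adj v s ∧ ¬ G.Adj b s := by
    by_contra hno
    push Not at hno
    have hlt : (T.filter (G.Adj v)).card < (T.filter (G.Adj b)).card := by
      apply Finset.card_lt_card
      rw [Finset.ssubset_iff_of_subset]
      · exact ⟨t, by simp [htT, htb.symm], by simp [hvt]⟩
      · intro s hs
        rw [Finset.mem_filter] at hs ⊢
        exact ⟨hs.1, hno s hs.1 hs.2⟩
    exact absurd (hvmax b hbB) (not_le.2 hlt)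
  have hst : G.Adj s t := hT hsT htT (fun h => hvt (h ▸ hvs))
  obtain ⟨p, hp⟩ := (hconn v hvB b hbB).exists_walk_length_eq_dist
  set l := p.length with hl
  have hpB : ∀ i, p.getVert i ∈ B := fun i => mem_of_within_reachable ⟨p.take i⟩ hvB
  have hdist : ∀ i ≤ l, D.dist v (p.getVert i) = i := by
    intro i hi
    have h1 : D.dist v (p.getVert i) ≤ i := (dist_le (p.take i)).trans (by simp)
    have h2 : D.dist (p.getVert i) b ≤ l - i := (dist_le (p.drop i)).trans (by simp [hl])
    have h3 := Reachable.dist_triangle_left (G := D) ⟨p.take i⟩ b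
    change l = D.dist v b at hp
    omega
  have hpadj : ∀ i j, i < j → j ≤ l → (G.Adj (p.getVert i) (p.getVert j) ↔ j = i + 1) := by
    intro i j hij hj
    constructor
    · intro h
      have hD : D.Adj (p.getVert i) (p.getVert j) := ⟨h, hpB i, hpB j⟩
      have h1 := dist_eq_one_iff_adj.2 hD
      have h2 := Reachable.dist_triangle_left (G := D) ⟨p.take i⟩ (p.getVert j)
      rw [h1, hdist i (by omega), hdist j hj] at h2
      omega
    · rintro rfl
      exact (p.adj_getVert_succ (by omega)).1
  have hpt : ∀ i ≤ l, (G.Adj (p.getVert i) t ↔ i = l) := by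
    intro i hi
    constructor
    · intro h
      have h1 := hmin _ (hpB i) h.symm
      rw [hdist i hi] at h1
      change l = D.dist v b at hp
      omega
    · rintro rfl
      rw [hl, p.getVert_length]
      exact htb.symm
  -- `p.getVert i` is the last neighbour of `s` on the path.
  obtain ⟨i, hil, his, hilast⟩ : ∃ i < l, G.Adj (p.getVert i) s ∧
      ∀ j ≤ l, i < j → ¬ G.Adj (p.getVert j) s := by
    have h0 : G.Adj (p.getVert 0) s := by rwa [p.getVert_zero]
    have hspec := Nat.findGreatest_spec (P := fun j => G.Adj (p.getVert j) s) (Nat.zero_le l) h0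
    refine ⟨_, lt_of_le_of_ne (Nat.findGreatest_le l) ?_, hspec, ?_⟩
    · intro he
      rw [he, hl, p.getVert_length] at hspec
      exact hbs hspec
    · intro j hj hij hjs
      exact absurd (Nat.le_findGreatest hj hjs) (not_le.2 hij)
  refine not_isChordal_of_cycle (G := G)
    (fun j => if j ≤ l - i then p.getVert (i + j) else if j = l - i + 1 then t else s)
    (l - i + 3) (by omega) ?_ ?_ hG
  · intro a c hac hc
    by_cases hc1 : c ≤ l - i
    · simp only [hc1, show a ≤ l - i by omega, if_true]
      intro h
      have := congrArg (D.dist v) h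
      rw [hdist _ (by omega), hdist _ (by omega)] at this
      omega
    · by_cases ha1 : a ≤ l - i
      · simp only [hc1, ha1, if_true, if_false]
        split_ifs
        · exact fun h => hTB t htT (h ▸ hpB _)
        · exact fun h => hTB s hsT (h ▸ hpB _)
      · simp only [show a = l - i + 1 by omega, show c = l - i + 2 by omega]
        simpa using hst.ne.symm
  · intro a c hac hc
    by_cases hc1 : c ≤ l - i
    · simp only [hc1, show a ≤ l - i by omega, if_true]
      rw [hpadj _ _ (by omega) (by omega)]
      omega
    · by_cases ha1 : a ≤ l - i
      · simp only [hc1, ha1, if_true, if_false]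
        by_cases hc2 : c = l - i + 1
        · rw [if_pos hc2, hpt _ (by omega)]
          omega
        · rw [if_neg hc2]
          constructor
          · intro h
            by_contra hne
            exact hilast (i + a) (by omega) (by omega) h
          · intro h
            have : a = 0 := by omega
            rw [this, add_zero]
            exact his
      · simp only [show a = l - i + 1 by omega, show c = l - i + 2 by omega]
        simpa using hst.symm

end Chordal

/-! ### Nodes of the contracted solution graph as classes of colorings -/

section Node

variable {V : Type*} {H : SimpleGraph V} {k : ℕ}

/-- The label component of a coloring. -/
noncomputable def node (T : Finset V) (α : H.Coloring (Fin k)) : CSGNode H k T :=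
  (existsUnique_labelComponent (colorGraph H k) (restrictTo H k T) α).choose

/-- Two colorings differ at most at one vertex, which lies outside `T`. -/
def TStep (T : Finset V) (α β : H.Coloring (Fin k)) : Prop :=
  ∃ v, v ∉ T ∧ ∀ w, w ≠ v → α w = β w

variable {T : Finset V}

theorem mem_node (α : H.Coloring (Fin k)) : α ∈ (node T α).1 :=
  (existsUnique_labelComponent (colorGraph H k) (restrictTo H k T) α).choose_spec.1

theorem node_eq_of_mem {α : H.Coloring (Fin k)} {x : CSGNode H k T} (h : α ∈ x.1) :
    node T α = x :=
  (existsUnique_labelComponent (colorGraph H k) (restrictTo H k T) α).unique (mem_node α) h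

theorem exists_node_eq (x : CSGNode H k T) : ∃ α, node T α = x :=
  (LabelComponent.nonempty _ _ x).imp fun _ h => node_eq_of_mem h

theorem csgLabel_node (α : H.Coloring (Fin k)) (t : T) : csgLabel H k T (node T α) t = α t :=
  congrFun (contractedLabel_eq (colorGraph H k) (restrictTo H k T) (node T α) (mem_node α)) t

theorem eq_of_node_eq {α β : H.Coloring (Fin k)} (h : node T α = node T β) {t : V} (ht : t ∈ T) :
    α t = β t := by
  rw [← csgLabel_node (T := T) α ⟨t, ht⟩, h, csgLabel_node]

theorem node_eq_of_tStep {α β : H.Coloring (Fin k)} (h : TStep T α β) : node T α = node T β := by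
  obtain ⟨v, hv, hαβ⟩ := h
  by_cases hne : α v = β v
  · congr 1
    ext w
    by_cases hw : w = v
    · rw [hw, hne]
    · rw [hαβ w hw]
  have hadj : (colorGraph H k).Adj α β :=
    ⟨v, hne, fun w hw => by_contra fun h => hw (hαβ w h)⟩
  have hlab : restrictTo H k T α = restrictTo H k T β := by
    funext t
    exact hαβ t fun h => hv (h ▸ t.2)
  have hx := (node T α).2
  have hy := (node T β).2
  let D := (node T α).1 ∪ (node T β).1
  have hD : (∀ a ∈ D, ∀ b ∈ D, restrictTo H k T a = restrictTo H k T b) ∧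
      ((colorGraph H k).induce D).Connected := by
    constructor
    · have : ∀ a ∈ D, restrictTo H k T a = restrictTo H k T α := by
        rintro a (ha | ha)
        · exact hx.prop.1 a ha α (mem_node α)
        · exact (hy.prop.1 a ha β (mem_node β)).trans hlab.symm
      exact fun a ha b hb => (this a ha).trans (this b hb).symm
    · exact connected_induce_union hx.prop.2.preconnected hy.prop.2.preconnected
        (mem_node α) (mem_node β) hadj
  apply Subtype.ext
  exact (hx.eq_of_subset hD Set.subset_union_left).trans
    (hy.eq_of_subset hD Set.subset_union_right).symm

theorem node_eq_iff {α β : H.Coloring (Fin k)} :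
    node T α = node T β ↔ Relation.ReflTransGen (TStep T) α β := by
  constructor
  · intro h
    have hα := mem_node (T := T) α
    rw [h] at hα
    have hr := (node T β).2.prop.2.preconnected ⟨α, hα⟩ ⟨β, mem_node β⟩
    rw [reachable_iff_reflTransGen] at hr
    refine Relation.ReflTransGen.lift Subtype.val ?_ _ _ hr
    rintro ⟨γ, hγ⟩ ⟨δ, hδ⟩ ⟨v, hv, huniq⟩
    refine ⟨v, fun hvT => hv ?_, fun w hw => by_contra fun h => hw (huniq w h)⟩
    exact congrFun ((node T β).2.prop.1 γ hγ δ hδ) ⟨v, hvT⟩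
  · intro h
    induction h with
    | refl => rfl
    | tail _ h ih => exact ih.trans (node_eq_of_tStep h)

theorem csg_adj_of_differ {α β : H.Coloring (Fin k)} {t : V} (ht : t ∈ T) (hne : α t ≠ β t)
    (h : ∀ w, w ≠ t → α w = β w) : (csg H k T).Adj (node T α) (node T β) :=
  ⟨fun he => hne (eq_of_node_eq he ht), α, mem_node α, β, mem_node β, t, hne,
    fun w hw => by_contra fun hwt => hw (h w hwt)⟩

theorem exists_of_csg_adj {x y : CSGNode H k T} (hxy : (csg H k T).Adj x y) :
    ∃ α β : H.Coloring (Fin k), node T α = x ∧ node T β = y ∧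
      ∃ t ∈ T, α t ≠ β t ∧ ∀ w, w ≠ t → α w = β w := by
  obtain ⟨hne, α, hα, β, hβ, t, hαβ, huniq⟩ := hxy
  have hdiff : ∀ w, w ≠ t → α w = β w := fun w hw => by_contra fun h => hw (huniq w h)
  refine ⟨α, β, node_eq_of_mem hα, node_eq_of_mem hβ, t, by_contra fun ht => hne ?_, hαβ, hdiff⟩
  rw [← node_eq_of_mem hα, ← node_eq_of_mem hβ]
  exact node_eq_of_tStep ⟨t, ht, hdiff⟩

theorem csgLabel_ne_of_adj {x y : CSGNode H k T} (hxy : (csg H k T).Adj x y) :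
    csgLabel H k T x ≠ csgLabel H k T y := by
  obtain ⟨α, β, rfl, rfl, t, ht, hne, -⟩ := exists_of_csg_adj hxy
  intro h
  have := congrFun h ⟨t, ht⟩
  rw [csgLabel_node, csgLabel_node] at this
  exact hne this

/-- Recoloring isolated vertices outside `T`, one after the other, stays within a label
component. -/
theorem node_eq_of_isolated [Finite V] {α β : H.Coloring (Fin k)} (hT : ∀ t ∈ T, α t = β t)
    (hD : ∀ v w, H.Adj v w → α v = β v) : node T α = node T β := by
  classical
  have := Fintype.ofFinite V
  suffices h : ∀ s : Finset V, ∀ γ : H.Coloring (Fin k),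
      (∀ v, γ v = if v ∈ s then β v else α v) → node T α = node T γ from
    h Finset.univ β (by simp)
  intro s
  induction s using Finset.induction_on with
  | empty =>
    intro γ hγ
    congr 1
    ext v
    rw [hγ]
    simp
  | insert a s _ ih =>
    intro γ hγ
    have hδ : ∀ {u v}, H.Adj u v →
        (if u ∈ s then β u else α u) ≠ (if v ∈ s then β v else α v) := by
      intro u v huv
      rw [← hD u v huv, ← hD v u huv.symm, ite_self, ite_self]
      exact α.valid huv
    rw [ih (Coloring.mk (fun v => if v ∈ s then β v else α v) hδ) (fun _ => rfl)]
    by_cases haT : a ∈ T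
    · congr 1
      ext v
      rw [hγ]
      change (if v ∈ s then β v else α v : Fin k).val = _
      by_cases hv : v = a
      · simp [hv, hT a haT]
      · simp [hv]
    · refine node_eq_of_tStep ⟨a, haT, fun v hv => ?_⟩
      rw [hγ]
      change (if v ∈ s then β v else α v) = _
      simp [hv]

/-- The same assignment of colors as a coloring of a graph with fewer edges. -/
def res {H₀ : SimpleGraph V} (h : H₀ ≤ H) (α : H.Coloring (Fin k)) : H₀.Coloring (Fin k) :=
  Coloring.mk α fun hadj => α.valid (h hadj)

theorem node_res_eq {H₀ : SimpleGraph V} (h : H₀ ≤ H) {T₀ : Finset V} (hT : T₀ ⊆ T)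
    {α β : H.Coloring (Fin k)} (hαβ : node T α = node T β) :
    node T₀ (res h α) = node T₀ (res h β) := by
  rw [node_eq_iff] at hαβ ⊢
  refine Relation.ReflTransGen.lift (res h) ?_ _ _ hαβ
  rintro γ δ ⟨v, hv, hγδ⟩
  exact ⟨v, fun hvT => hv (hT hvT), hγδ⟩

/-- The map of contracted solution graphs that forgets edges of the graph and terminals. -/
noncomputable def resNode {H₀ : SimpleGraph V} (h : H₀ ≤ H) (T T₀ : Finset V)
    (x : CSGNode H k T) : CSGNode H₀ k T₀ :=
  node T₀ (res h (exists_node_eq x).choose)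

theorem resNode_node {H₀ : SimpleGraph V} (h : H₀ ≤ H) {T₀ : Finset V} (hT : T₀ ⊆ T)
    (α : H.Coloring (Fin k)) : resNode h T T₀ (node T α) = node T₀ (res h α) :=
  node_res_eq h hT (exists_node_eq (node T α)).choose_spec

theorem csgLabel_resNode {H₀ : SimpleGraph V} (h : H₀ ≤ H) {T₀ : Finset V} (hT : T₀ ⊆ T)
    (x : CSGNode H k T) (t : T₀) :
    csgLabel H₀ k T₀ (resNode h T T₀ x) t = csgLabel H k T x ⟨t, hT t.2⟩ := by
  obtain ⟨α, rfl⟩ := exists_node_eq x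
  rw [resNode_node h hT, csgLabel_node, csgLabel_node]
  rfl

theorem csg_adj_resNode {H₀ : SimpleGraph V} (h : H₀ ≤ H) {x y : CSGNode H k T}
    (hxy : (csg H k T).Adj x y) :
    (csg H₀ k T).Adj (resNode h T T x) (resNode h T T y) := by
  obtain ⟨α, β, rfl, rfl, t, ht, hne, hdiff⟩ := exists_of_csg_adj hxy
  rw [resNode_node h subset_rfl, resNode_node h subset_rfl]
  exact csg_adj_of_differ ht hne hdiff

/-- A recoloring sequence that fixes `T₀` can be carried out on `A` alone, with the colors outside
`A` kept, if the edges leaving `A` do so at `T₀`. -/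
theorem node_eq_of_node_eq {H₀ : SimpleGraph V} {A : Set V} {T₀ : Finset V}
    (hT : ∀ v ∈ A, v ∈ T → v ∈ T₀)
    (hH : ∀ u v, H.Adj u v → H₀.Adj u v ∧ u ∈ A ∧ v ∈ A ∨
      u ∈ Aᶜ ∪ (T₀ : Set V) ∧ v ∈ Aᶜ ∪ (T₀ : Set V))
    {γ γ' : H₀.Coloring (Fin k)} (h : node T₀ γ = node T₀ γ') {δ δ' : H.Coloring (Fin k)}
    (hδ : ∀ w ∈ A, δ w = γ w) (hδ' : ∀ w ∈ A, δ' w = γ' w) (hout : ∀ w, w ∉ A → δ w = δ' w) :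
    node T δ = node T δ' := by
  classical
  rw [node_eq_iff] at h
  revert δ'
  induction h with
  | refl =>
    intro δ' hδ' hout
    congr 1
    ext w
    by_cases hw : w ∈ A
    · rw [hδ w hw, hδ' w hw]
    · rw [hout w hw]
  | @tail γ' γ'' h hstep ih =>
    intro δ'' hδ'' hout
    have hfix : ∀ w ∈ Aᶜ ∪ (T₀ : Set V), (if w ∈ A then γ' w else δ w) = δ w := by
      intro w hw
      split_ifs with hwA
      · have hwT : w ∈ T₀ := hw.resolve_left fun h => h hwA
        rw [hδ w hwA]
        exact (eq_of_node_eq (node_eq_iff.2 h) hwT).symm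
      · rfl
    have hproper : ∀ {u v}, H.Adj u v →
        (if u ∈ A then γ' u else δ u) ≠ (if v ∈ A then γ' v else δ v) := by
      intro u v huv
      rcases hH u v huv with ⟨h0, hu, hv⟩ | ⟨hu, hv⟩
      · rw [if_pos hu, if_pos hv]
        exact γ'.valid h0
      · rw [hfix u hu, hfix v hv]
        exact δ.valid huv
    rw [ih (δ' := Coloring.mk (fun w => if w ∈ A then γ' w else δ w) hproper)
      (fun w hw => if_pos hw) (fun w hw => (if_neg hw).symm)]
    obtain ⟨v, hv, hγ⟩ := hstep
    have hdiff : ∀ w, w ∈ A → w ≠ v ∨ γ' w = γ'' w →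
        (if w ∈ A then γ' w else δ w) = δ'' w := by
      intro w hw h
      rw [if_pos hw, hδ'' w hw]
      exact h.elim (hγ w) id
    by_cases hvA : v ∈ A
    · refine node_eq_of_tStep ⟨v, fun h => hv (hT v hvA h), fun w hw => ?_⟩
      change (if w ∈ A then γ' w else δ w) = δ'' w
      by_cases hwA : w ∈ A
      · exact hdiff w hwA (Or.inl hw)
      · rw [if_neg hwA, hout w hwA]
    · congr 1
      ext w
      change (if w ∈ A then γ' w else δ w : Fin k).val = δ'' w
      by_cases hwA : w ∈ A
      · rw [hdiff w hwA (Or.inl fun h => hvA (h ▸ hwA))]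
      · rw [if_neg hwA, hout w hwA]

end Node

/-! ### The two outcomes -/

section Outcome

variable {V : Type*}

/-- The contracted solution graph is a forest with the injective neighborhood property. -/
def IsForestINP (H : SimpleGraph V) (k : ℕ) (T : Finset V) : Prop :=
  (csg H k T).IsAcyclic ∧ InjectiveNeighborhood (csg H k T) (csgLabel H k T)

/-- The contracted solution graph is determined by the labels alone: every coloring of the clique
`T` extends to `H`, extensions of the same coloring lie in the same label component, and each
recoloring of a vertex of `T` that is possible on `T` is possible in `H`. Colorings of `T` are
given as restrictions of functions on all vertices. -/
structure IsUnobstructed (H : SimpleGraph V) (k : ℕ) (T : Finset V) : Prop where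
  exists_coloring : ∀ L : V → Fin k, Set.InjOn L T → ∃ α : H.Coloring (Fin k), ∀ t ∈ T, α t = L t
  node_eq : ∀ α β : H.Coloring (Fin k), (∀ t ∈ T, α t = β t) → node T α = node T β
  exists_step : ∀ L L' : V → Fin k, Set.InjOn L T → Set.InjOn L' T → ∀ t ∈ T, L t ≠ L' t →
    (∀ s ∈ T, s ≠ t → L s = L' s) → ∃ α β : H.Coloring (Fin k), (∀ s ∈ T, α s = L s) ∧
      (∀ s ∈ T, β s = L' s) ∧ ∀ w, w ≠ t → α w = β w

variable {H : SimpleGraph V} {k : ℕ} {T : Finset V}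

theorem injOn_of_isClique (hT : H.IsClique (T : Set V)) (α : H.Coloring (Fin k)) :
    Set.InjOn α T := by
  intro s hs t ht hst
  by_contra hne
  exact α.valid (hT hs ht hne) hst

theorem IsUnobstructed.csg_adj (h : IsUnobstructed H k T) (hT : H.IsClique (T : Set V))
    {α β : H.Coloring (Fin k)} {t : V} (ht : t ∈ T) (hne : α t ≠ β t)
    (heq : ∀ s ∈ T, s ≠ t → α s = β s) : (csg H k T).Adj (node T α) (node T β) := by
  obtain ⟨α', β', hα, hβ, hdiff⟩ := h.exists_step α β (injOn_of_isClique hT α)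
    (injOn_of_isClique hT β) t ht hne heq
  rw [← h.node_eq _ _ hα, ← h.node_eq _ _ hβ]
  refine csg_adj_of_differ ht ?_ hdiff
  rwa [hα t ht, hβ t ht]

theorem IsUnobstructed.injectiveNeighborhood (h : IsUnobstructed H k T) :
    InjectiveNeighborhood (csg H k T) (csgLabel H k T) := by
  intro x y z _ _ hyz hlab
  obtain ⟨α, rfl⟩ := exists_node_eq y
  obtain ⟨β, rfl⟩ := exists_node_eq z
  refine hyz (h.node_eq _ _ fun t ht => ?_)
  have := congrFun hlab ⟨t, ht⟩
  rwa [csgLabel_node, csgLabel_node] at this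

theorem IsUnobstructed.isColorComplete (h : IsUnobstructed H k T) (hT : H.IsClique (T : Set V))
    (h1 : 1 ≤ T.card) (hk : T.card ≤ k) :
    IsColorComplete T.card k (csg H k T) (csgLabel H k T) where
  one_le := h1
  le := hk
  card_eq := by simp
  label_coloring x := by
    obtain ⟨α, rfl⟩ := exists_node_eq x
    refine ⟨Coloring.mk (fun t => α t) fun {s t} hst => ?_, ?_⟩
    · exact α.valid (hT s.2 t.2 fun he => hst.ne (Subtype.ext he))
    · funext t
      exact csgLabel_node α t
  existsUnique_label γ := by
    classical
    let L : V → Fin k := fun v => if hv : v ∈ T then γ ⟨v, hv⟩ else ⟨0, by omega⟩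
    have hL : ∀ t (ht : t ∈ T), L t = γ ⟨t, ht⟩ := fun t ht => dif_pos ht
    have hinj : Set.InjOn L T := by
      intro s hs t ht hst
      rw [hL s hs, hL t ht] at hst
      by_contra hne
      exact γ.valid (v := ⟨s, hs⟩) (w := ⟨t, ht⟩)
        ((top_adj _ _).2 fun he => hne (congrArg Subtype.val he)) hst
    obtain ⟨α, hα⟩ := h.exists_coloring L hinj
    refine ⟨node T α, ?_, fun y hy => ?_⟩
    · funext t
      rw [csgLabel_node, hα t t.2, hL t t.2]
    · obtain ⟨β, rfl⟩ := exists_node_eq y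
      refine h.node_eq _ _ fun t ht => ?_
      rw [hα t ht, hL t ht, ← hy]
      exact (csgLabel_node β ⟨t, ht⟩).symm
  adj_iff x y := by
    constructor
    · intro hxy
      obtain ⟨α, β, rfl, rfl, t, ht, hne, hdiff⟩ := exists_of_csg_adj hxy
      refine ⟨⟨t, ht⟩, ?_, fun s hs => ?_⟩
      · simp only [csgLabel_node]
        exact hne
      · simp only [csgLabel_node] at hs
        exact Subtype.ext (by_contra fun hst => hs (hdiff s hst))
    · obtain ⟨α, rfl⟩ := exists_node_eq x
      obtain ⟨β, rfl⟩ := exists_node_eq y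
      rintro ⟨⟨t, ht⟩, hne, huniq⟩
      simp only [csgLabel_node] at hne huniq
      exact h.csg_adj hT ht hne fun s hs hst => by_contra fun h' =>
        hst (congrArg Subtype.val (huniq ⟨s, hs⟩ h'))

/-- If `T` lies in a clique of size `k`, then no vertex of `T` can ever be recolored. -/
theorem isForestINP_of_subset_clique {K : Finset V} (hK : H.IsClique (K : Set V))
    (hcard : K.card = k) (hTK : T ⊆ K) : IsForestINP H k T := by
  classical
  have hno : ∀ x y, ¬ (csg H k T).Adj x y := by
    intro x y hxy
    obtain ⟨α, β, rfl, rfl, t, ht, hne, hdiff⟩ := exists_of_csg_adj hxy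
    have himg : K.image α = Finset.univ := by
      rw [← Finset.card_eq_iff_eq_univ, Finset.card_image_of_injOn (injOn_of_isClique hK α),
        hcard, Fintype.card_fin]
    obtain ⟨s, hs, hst⟩ := Finset.mem_image.1 (himg ▸ Finset.mem_univ (β t))
    by_cases h : s = t
    · exact hne (h ▸ hst)
    · rw [hdiff s h] at hst
      exact h (injOn_of_isClique hK β hs (hTK ht) hst)
  refine ⟨isAcyclic_iff_forall_adj_isBridge.2 fun x y hxy => absurd hxy (hno x y), ?_⟩
  exact fun x y _ hxy => absurd hxy (hno x y)

/-- If all edges lie inside the clique `T`, there is no obstruction to recoloring `T`. -/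
theorem isUnobstructed_of_forall_mem [Finite V] (hH : ∀ u v, H.Adj u v → u ∈ T ∧ v ∈ T) :
    IsUnobstructed H k T := by
  have hcol : ∀ L : V → Fin k, Set.InjOn L T → ∀ {u v}, H.Adj u v → L u ≠ L v :=
    fun L hL u v huv he => huv.ne (hL (hH u v huv).1 (hH u v huv).2 he)
  refine ⟨fun L hL => ⟨Coloring.mk L (hcol L hL), fun _ _ => rfl⟩, fun α β h => ?_, ?_⟩
  · exact node_eq_of_isolated h fun v w hvw => h v (hH v w hvw).1
  · classical
    intro L L' hL hL' t ht _ heq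
    have hupd : ∀ s ∈ T, Function.update L t (L' t) s = L' s := by
      intro s hs
      by_cases hst : s = t
      · rw [hst, Function.update_self]
      · rw [Function.update_of_ne hst, heq s hs hst]
    refine ⟨Coloring.mk L (hcol L hL), Coloring.mk (Function.update L t (L' t)) (hcol _ ?_),
      fun _ _ => rfl, hupd, fun w hw => (Function.update_of_ne hw _ _).symm⟩
    intro r hr s hs hrs
    rw [hupd r hr, hupd s hs] at hrs
    exact hL' hr hs hrs

end Outcome

/-! ### Gluing two graphs along the terminals -/

section Join

variable {V : Type*} {H H₁ H₂ : SimpleGraph V} {k : ℕ} {T : Finset V} {A : Set V}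

/-- The color function that follows `α` on `A` and `β` elsewhere is a coloring, provided that `α`
and `β` agree on the set `T` along which the two sides are glued. -/
theorem exists_glue
    (hH : ∀ u v, H.Adj u v → H₁.Adj u v ∧ u ∈ A ∧ v ∈ A ∨
      H₂.Adj u v ∧ u ∈ Aᶜ ∪ (T : Set V) ∧ v ∈ Aᶜ ∪ (T : Set V))
    (α : H₁.Coloring (Fin k)) (β : H₂.Coloring (Fin k)) (h : ∀ t ∈ T, α t = β t) :
    ∃ γ : H.Coloring (Fin k), (∀ w ∈ A, γ w = α w) ∧ ∀ w ∈ Aᶜ ∪ (T : Set V), γ w = β w := by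
  classical
  have h2 : ∀ w ∈ Aᶜ ∪ (T : Set V), (if w ∈ A then α w else β w) = β w := by
    intro w hw
    split_ifs with hwA
    · exact h w (hw.resolve_left fun h => h hwA)
    · rfl
  refine ⟨Coloring.mk (fun w => if w ∈ A then α w else β w) ?_, fun w hw => if_pos hw, h2⟩
  intro u v huv
  rcases hH u v huv with ⟨h0, hu, hv⟩ | ⟨h0, hu, hv⟩
  · simp only [hu, hv, if_true]
    exact α.valid h0
  · rw [h2 u hu, h2 v hv]
    exact β.valid h0

/-- A node of the glued graph is determined by its two projections. -/
theorem node_eq_of_res_eq (h₁ : H₁ ≤ H) (h₂ : H₂ ≤ H)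
    (hH : ∀ u v, H.Adj u v → H₁.Adj u v ∧ u ∈ A ∧ v ∈ A ∨
      H₂.Adj u v ∧ u ∈ Aᶜ ∪ (T : Set V) ∧ v ∈ Aᶜ ∪ (T : Set V))
    {α β : H.Coloring (Fin k)} (hαβ₁ : node T (res h₁ α) = node T (res h₁ β))
    (hαβ₂ : node T (res h₂ α) = node T (res h₂ β)) : node T α = node T β := by
  have hag : ∀ t ∈ T, β t = α t := fun t ht => (eq_of_node_eq hαβ₁ ht).symm
  obtain ⟨γ, hγ₁, hγ₂⟩ := exists_glue hH (res h₁ β) (res h₂ α) hag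
  have e1 : node T α = node T γ := by
    refine node_eq_of_node_eq (A := A) (fun _ _ h => h) ?_ hαβ₁ (fun _ _ => rfl) hγ₁
      fun w hw => (hγ₂ w (Or.inl hw)).symm
    exact fun u v huv => (hH u v huv).imp id fun h => h.2
  have e2 : node T γ = node T β := by
    refine node_eq_of_node_eq (A := Aᶜ ∪ (T : Set V)) (fun _ _ h => h) ?_ hαβ₂ hγ₂
      (fun _ _ => rfl) fun w hw => ?_
    · intro u v huv
      have hsub : ∀ w ∈ A, w ∈ (Aᶜ ∪ (T : Set V))ᶜ ∪ (T : Set V) := by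
        intro w hw
        by_cases hwT : w ∈ (T : Set V)
        · exact Or.inr hwT
        · exact Or.inl fun h => h.elim (fun h => h hw) hwT
      rcases hH u v huv with ⟨-, hu, hv⟩ | h
      · exact Or.inr ⟨hsub u hu, hsub v hv⟩
      · exact Or.inl h
    · exact hγ₁ w (by_contra fun h => hw (Or.inl h))
  exact e1.trans e2

/-- Neighbors with equal labels have equal projections, since those are neighbors with equal labels
as well. -/
theorem join_injectiveNeighborhood (h₁ : H₁ ≤ H) (h₂ : H₂ ≤ H)
    (hH : ∀ u v, H.Adj u v → H₁.Adj u v ∧ u ∈ A ∧ v ∈ A ∨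
      H₂.Adj u v ∧ u ∈ Aᶜ ∪ (T : Set V) ∧ v ∈ Aᶜ ∪ (T : Set V))
    (i₁ : InjectiveNeighborhood (csg H₁ k T) (csgLabel H₁ k T))
    (i₂ : InjectiveNeighborhood (csg H₂ k T) (csgLabel H₂ k T)) :
    InjectiveNeighborhood (csg H k T) (csgLabel H k T) := by
  intro x y z hxy hxz hyz hlab
  have hproj : ∀ {H' : SimpleGraph V} (h : H' ≤ H),
      InjectiveNeighborhood (csg H' k T) (csgLabel H' k T) →
        resNode h T T y = resNode h T T z := by
    intro H' h i
    by_contra hne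
    refine i _ _ _ (csg_adj_resNode h hxy) (csg_adj_resNode h hxz) hne ?_
    funext t
    rw [csgLabel_resNode h subset_rfl, csgLabel_resNode h subset_rfl, hlab]
  have e1 := hproj h₁ i₁
  have e2 := hproj h₂ i₂
  obtain ⟨α, rfl⟩ := exists_node_eq y
  obtain ⟨β, rfl⟩ := exists_node_eq z
  rw [resNode_node _ subset_rfl, resNode_node _ subset_rfl] at e1 e2
  exact hyz (node_eq_of_res_eq h₁ h₂ hH e1 e2)

/-- The projection to a subgraph with the same terminals preserves labels, so the injective
neighborhood property makes it locally injective. -/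
theorem isAcyclic_of_injectiveNeighborhood {H₀ : SimpleGraph V} (h : H₀ ≤ H)
    (i : InjectiveNeighborhood (csg H k T) (csgLabel H k T)) (h₀ : (csg H₀ k T).IsAcyclic) :
    (csg H k T).IsAcyclic := by
  refine isAcyclic_of_locallyInjective (f := resNode h T T)
    (fun x y hxy => csg_adj_resNode h hxy) (fun x y z hxy hxz he => ?_) h₀
  by_contra hne
  refine i x y z hxy hxz hne ?_
  funext t
  rw [← csgLabel_resNode h subset_rfl, ← csgLabel_resNode h subset_rfl, he]

theorem join_isUnobstructed (h₁ : H₁ ≤ H) (h₂ : H₂ ≤ H) (hTA : (T : Set V) ⊆ A)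
    (hH : ∀ u v, H.Adj u v → H₁.Adj u v ∧ u ∈ A ∧ v ∈ A ∨
      H₂.Adj u v ∧ u ∈ Aᶜ ∪ (T : Set V) ∧ v ∈ Aᶜ ∪ (T : Set V))
    (i₁ : IsUnobstructed H₁ k T) (i₂ : IsUnobstructed H₂ k T) : IsUnobstructed H k T := by
  refine ⟨fun L hL => ?_, fun α β h => ?_, fun L L' hL hL' t ht hne heq => ?_⟩
  · obtain ⟨α, hα⟩ := i₁.exists_coloring L hL
    obtain ⟨β, hβ⟩ := i₂.exists_coloring L hL
    obtain ⟨γ, hγ, -⟩ := exists_glue hH α β fun t ht => (hα t ht).trans (hβ t ht).symm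
    exact ⟨γ, fun t ht => (hγ t (hTA ht)).trans (hα t ht)⟩
  · exact node_eq_of_res_eq h₁ h₂ hH (i₁.node_eq _ _ h) (i₂.node_eq _ _ h)
  · obtain ⟨α, β, hα, hβ, hαβ⟩ := i₁.exists_step L L' hL hL' t ht hne heq
    obtain ⟨α', β', hα', hβ', hαβ'⟩ := i₂.exists_step L L' hL hL' t ht hne heq
    obtain ⟨γ, hγ, hγ'⟩ := exists_glue hH α α' fun t ht => (hα t ht).trans (hα' t ht).symm
    obtain ⟨δ, hδ, hδ'⟩ := exists_glue hH β β' fun t ht => (hβ t ht).trans (hβ' t ht).symm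
    refine ⟨γ, δ, fun t ht => (hγ t (hTA ht)).trans (hα t ht),
      fun t ht => (hδ t (hTA ht)).trans (hβ t ht), fun w hw => ?_⟩
    by_cases hwA : w ∈ A
    · rw [hγ w hwA, hδ w hwA, hαβ w hw]
    · rw [hγ' w (Or.inl hwA), hδ' w (Or.inl hwA), hαβ' w hw]

/-- Without obstruction on both sides there is none in the glued graph; otherwise the projection to a
side that is a forest shows that the glued graph yields a forest. -/
theorem join_outcome (h₁ : H₁ ≤ H) (h₂ : H₂ ≤ H) (hTA : (T : Set V) ⊆ A)
    (hH : ∀ u v, H.Adj u v → H₁.Adj u v ∧ u ∈ A ∧ v ∈ A ∨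
      H₂.Adj u v ∧ u ∈ Aᶜ ∪ (T : Set V) ∧ v ∈ Aᶜ ∪ (T : Set V))
    (o₁ : IsUnobstructed H₁ k T ∨ IsForestINP H₁ k T)
    (o₂ : IsUnobstructed H₂ k T ∨ IsForestINP H₂ k T) :
    IsUnobstructed H k T ∨ IsForestINP H k T := by
  have hinj := join_injectiveNeighborhood h₁ h₂ hH
    (o₁.elim (fun h => h.injectiveNeighborhood) fun h => h.2)
    (o₂.elim (fun h => h.injectiveNeighborhood) fun h => h.2)
  rcases o₁ with u₁ | f₁
  · rcases o₂ with u₂ | f₂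
    · exact Or.inl (join_isUnobstructed h₁ h₂ hTA hH u₁ u₂)
    · exact Or.inr ⟨isAcyclic_of_injectiveNeighborhood h₂ hinj f₂.1, hinj⟩
  · exact Or.inr ⟨isAcyclic_of_injectiveNeighborhood h₁ hinj f₁.1, hinj⟩

end Join

/-! ### Counting the colors missing on a clique -/

section Colors

variable {V : Type*} [DecidableEq V] {k : ℕ} {T₀ : Finset V} {u : V}

theorem eq_of_notMem_of_card {S : Finset (Fin k)} (hS : S.card + 1 = k) {c d : Fin k}
    (hc : c ∉ S) (hd : d ∉ S) : c = d := by
  have h : Sᶜ.card ≤ 1 := by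
    rw [Finset.card_compl, Fintype.card_fin]
    omega
  exact Finset.card_le_one.1 h c (by simpa using hc) d (by simpa using hd)

/-- Given the colors of `T₀`, just two colors remain for `u`. -/
theorem eq_of_ne_of_ne (hcard : T₀.card + 2 = k) (hu : u ∉ T₀) {α β γ : V → Fin k}
    (hα : Set.InjOn α (insert u T₀ : Finset V)) (hβ : Set.InjOn β (insert u T₀ : Finset V))
    (hγ : Set.InjOn γ (insert u T₀ : Finset V)) (hαβ : ∀ s ∈ T₀, α s = β s)
    (hαγ : ∀ s ∈ T₀, α s = γ s) (h1 : β u ≠ α u) (h2 : γ u ≠ α u) : β u = γ u := by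
  have hne : ∀ δ : V → Fin k, Set.InjOn δ (insert u T₀ : Finset V) → (∀ s ∈ T₀, α s = δ s) →
      ∀ s ∈ T₀, α s ≠ δ u := by
    intro δ hδ hαδ s hs h
    rw [hαδ s hs] at h
    exact hu (hδ (by simp [hs]) (by simp) h ▸ hs)
  have hnot : ∀ δ : V → Fin k, Set.InjOn δ (insert u T₀ : Finset V) → (∀ s ∈ T₀, α s = δ s) →
      δ u ∉ T₀.image α := by
    intro δ hδ hαδ h
    obtain ⟨s, hs, hsu⟩ := Finset.mem_image.1 h
    exact hne δ hδ hαδ s hs hsu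
  refine eq_of_notMem_of_card (S := insert (α u) (T₀.image α)) ?_ ?_ ?_
  · rw [Finset.card_insert_of_notMem (hnot α hα fun _ _ => rfl), Finset.card_image_of_injOn]
    · omega
    · exact hα.mono (by simp)
  · rw [Finset.mem_insert, not_or]
    exact ⟨h1, hnot β hβ hαβ⟩
  · rw [Finset.mem_insert, not_or]
    exact ⟨h2, hnot γ hγ hαγ⟩

/-- A recoloring of a vertex of `T₀` leaves just one possible color for `u`, namely the one that is
missing on `T₀` both before and after. -/
theorem eq_of_recoloring (hcard : T₀.card + 2 = k) (hu : u ∉ T₀) {α β α' β' : V → Fin k}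
    (hα : Set.InjOn α (insert u T₀ : Finset V)) (hβ : Set.InjOn β (insert u T₀ : Finset V))
    (hα' : Set.InjOn α' (insert u T₀ : Finset V)) (hβ' : Set.InjOn β' (insert u T₀ : Finset V))
    {t : V} (ht : t ∈ T₀) (hne : α t ≠ β t) (hdiff : ∀ w, w ≠ t → α w = β w)
    (hu' : α' u = β' u) (hαα' : ∀ s ∈ T₀, α s = α' s) (hββ' : ∀ s ∈ T₀, β s = β' s) :
    α u = α' u := by
  have hmem : ∀ {s}, s ∈ T₀ → s ∈ ((insert u T₀ : Finset V) : Set V) := by simp +contextual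
  have humem : u ∈ ((insert u T₀ : Finset V) : Set V) := by simp
  have hut : u ≠ t := fun h => hu (h ▸ ht)
  refine eq_of_notMem_of_card (S := insert (β t) (T₀.image α)) ?_ ?_ ?_
  · rw [Finset.card_insert_of_notMem, Finset.card_image_of_injOn]
    · omega
    · exact hα.mono (by simp)
    · intro h
      obtain ⟨s, hs, hst⟩ := Finset.mem_image.1 h
      by_cases h' : s = t
      · exact hne (h' ▸ hst)
      · rw [hdiff s h'] at hst
        exact h' (hβ (hmem hs) (hmem ht) hst)
  · simp only [Finset.mem_insert, Finset.mem_image, not_or, not_exists, not_and]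
    refine ⟨fun h => ?_, fun s hs h => hu (hα (hmem hs) humem h ▸ hs)⟩
    rw [hdiff u hut] at h
    exact hut (hβ humem (hmem ht) h)
  · simp only [Finset.mem_insert, Finset.mem_image, not_or, not_exists, not_and]
    refine ⟨fun h => ?_, fun s hs h => ?_⟩
    · rw [hu', hββ' t ht] at h
      exact hut (hβ' humem (hmem ht) h)
    · rw [hαα' s hs] at h
      exact hu (hα' (hmem hs) humem h ▸ hs)

end Colors

/-! ### Introducing a terminal whose neighbours are the old terminals -/

section Introduce

variable {V : Type*} [DecidableEq V] {H H₀ : SimpleGraph V} {k : ℕ} {T₀ : Finset V} {u : V}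

/-- A coloring of `H₀` extends to the new vertex `u` by any color that does not occur on `T₀`. -/
theorem exists_extend (hH : ∀ x y, H.Adj x y → H₀.Adj x y ∧ x ≠ u ∧ y ≠ u ∨
      x ∈ insert u T₀ ∧ y ∈ insert u T₀)
    (α : H₀.Coloring (Fin k)) (L : V → Fin k) (hL : Set.InjOn L (insert u T₀ : Finset V))
    (h : ∀ t ∈ T₀, α t = L t) :
    ∃ γ : H.Coloring (Fin k), (∀ t ∈ insert u T₀, γ t = L t) ∧ ∀ w, w ≠ u → γ w = α w := by
  have h2 : ∀ w ∈ insert u T₀, Function.update α u (L u) w = L w := by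
    intro w hw
    by_cases hwu : w = u
    · rw [hwu, Function.update_self]
    · rw [Function.update_of_ne hwu]
      exact h w ((Finset.mem_insert.1 hw).resolve_left hwu)
  refine ⟨Coloring.mk (Function.update α u (L u)) ?_, h2,
    fun w hw => Function.update_of_ne hw _ _⟩
  intro x y hxy
  rcases hH x y hxy with ⟨h0, hx, hy⟩ | ⟨hx, hy⟩
  · rw [Function.update_of_ne hx, Function.update_of_ne hy]
    exact α.valid h0
  · rw [h2 x hx, h2 y hy]
    exact fun he => hxy.ne (hL hx hy he)

/-- A node is determined by its projection together with the color of the new terminal. -/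
theorem node_eq_of_res_eq_of_eq (h₀ : H₀ ≤ H)
    (hH : ∀ x y, H.Adj x y → H₀.Adj x y ∧ x ≠ u ∧ y ≠ u ∨ x ∈ insert u T₀ ∧ y ∈ insert u T₀)
    {α β : H.Coloring (Fin k)} (h : node T₀ (res h₀ α) = node T₀ (res h₀ β)) (hu : α u = β u) :
    node (insert u T₀) α = node (insert u T₀) β := by
  refine node_eq_of_node_eq (A := {u}ᶜ) ?_ ?_ h (fun _ _ => rfl) (fun _ _ => rfl) ?_
  · intro v hv hvT
    exact (Finset.mem_insert.1 hvT).resolve_left hv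
  · intro x y hxy
    rcases hH x y hxy with h | ⟨hx, hy⟩
    · exact Or.inl h
    · exact Or.inr ⟨by simpa using hx, by simpa using hy⟩
  · intro w hw
    rw [Set.mem_compl_iff, not_not, Set.mem_singleton_iff] at hw
    rw [hw, hu]

/-- The new terminal doubles every node, one copy for each of the two colors left for `u`. In the
forest case, the injective neighborhood property is inherited because a recoloring of `u` is the
only edge at a node that projects to a single node. -/
theorem introduce_outcome (h₀ : H₀ ≤ H)
    (hH : ∀ x y, H.Adj x y → H₀.Adj x y ∧ x ≠ u ∧ y ≠ u ∨ x ∈ insert u T₀ ∧ y ∈ insert u T₀)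
    (hT : H.IsClique ((insert u T₀ : Finset V) : Set V)) (hu : u ∉ T₀) (hcard : T₀.card + 2 = k)
    (o : IsUnobstructed H₀ k T₀ ∨ IsForestINP H₀ k T₀) :
    IsUnobstructed H k (insert u T₀) ∨ IsForestINP H k (insert u T₀) := by
  have hsub : T₀ ⊆ insert u T₀ := Finset.subset_insert u T₀
  rcases o with o | ⟨hac, hinp⟩
  · left
    refine ⟨fun L hL => ?_, fun α β h => ?_, fun L L' hL hL' t ht hne heq => ?_⟩
    · obtain ⟨α, hα⟩ := o.exists_coloring L (hL.mono (by simp))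
      obtain ⟨γ, hγ, -⟩ := exists_extend hH α L hL hα
      exact ⟨γ, hγ⟩
    · exact node_eq_of_res_eq_of_eq h₀ hH (o.node_eq _ _ fun t ht => h t (hsub ht))
        (h u (Finset.mem_insert_self u T₀))
    · obtain ⟨α, β, hα, hβ, hαβ⟩ : ∃ α β : H₀.Coloring (Fin k), (∀ s ∈ T₀, α s = L s) ∧
          (∀ s ∈ T₀, β s = L' s) ∧ ∀ w, w ≠ u → w ≠ t → α w = β w := by
        by_cases htu : t = u
        · obtain ⟨α, hα⟩ := o.exists_coloring L (hL.mono (by simp))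
          refine ⟨α, α, hα, fun s hs => ?_, fun _ _ _ => rfl⟩
          rw [hα s hs]
          exact heq s (hsub hs) fun h => hu (htu ▸ h ▸ hs)
        · obtain ⟨α, β, hα, hβ, hαβ⟩ := o.exists_step L L' (hL.mono (by simp))
            (hL'.mono (by simp)) t ((Finset.mem_insert.1 ht).resolve_left htu) hne
            fun s hs => heq s (hsub hs)
          exact ⟨α, β, hα, hβ, fun w _ => hαβ w⟩
      obtain ⟨γ, hγ, hγ'⟩ := exists_extend hH α L hL hα
      obtain ⟨δ, hδ, hδ'⟩ := exists_extend hH β L' hL' hβ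
      refine ⟨γ, δ, hγ, hδ, fun w hw => ?_⟩
      by_cases hwu : w = u
      · have hum : u ∈ insert u T₀ := Finset.mem_insert_self u T₀
        rw [hwu, hγ u hum, hδ u hum]
        exact heq u hum (hwu ▸ hw)
      · rw [hγ' w hwu, hδ' w hwu, hαβ w hwu hw]
  · right
    have hinj := fun α : H.Coloring (Fin k) => injOn_of_isClique hT α
    have hum : u ∈ insert u T₀ := Finset.mem_insert_self u T₀
    let f : CSGNode H k (insert u T₀) → CSGNode H₀ k T₀ := resNode h₀ (insert u T₀) T₀
    have hf : ∀ α : H.Coloring (Fin k), f (node _ α) = node T₀ (res h₀ α) :=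
      resNode_node h₀ hsub
    -- An edge of the graph either recolors `u` or projects to an edge.
    have hcase : ∀ x y, (csg H k (insert u T₀)).Adj x y →
        f x = f y ∨ (csg H₀ k T₀).Adj (f x) (f y) := by
      intro x y hxy
      obtain ⟨α, β, rfl, rfl, t, ht, hne, hdiff⟩ := exists_of_csg_adj hxy
      rw [hf, hf]
      rcases Finset.mem_insert.1 ht with rfl | ht
      · exact Or.inl (node_eq_of_tStep ⟨t, hu, hdiff⟩)
      · exact Or.inr (csg_adj_of_differ ht hne hdiff)
    refine ⟨isAcyclic_of_expansion (f := f) hcase ?_ ?_ hac, ?_⟩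
    · intro x y x' y' hxy hxy' hne hx hy
      obtain ⟨α, β, rfl, rfl, t, ht, hαβ, hdiff⟩ := exists_of_csg_adj hxy
      obtain ⟨α', β', rfl, rfl, t', ht', hαβ', hdiff'⟩ := exists_of_csg_adj hxy'
      have hne' := hne
      rw [hx, hy] at hne'
      rw [hf, hf] at hne hne' hx hy
      have ht0 : t ∈ T₀ := (Finset.mem_insert.1 ht).resolve_left fun h =>
        hne (node_eq_of_tStep ⟨t, h ▸ hu, hdiff⟩)
      have hut' : u ≠ t' := fun h => hne' (node_eq_of_tStep ⟨t', h ▸ hu, hdiff'⟩)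
      refine node_eq_of_res_eq_of_eq h₀ hH hx ?_
      exact eq_of_recoloring hcard hu (hinj α) (hinj β) (hinj α') (hinj β') ht0 hαβ hdiff
        (hdiff' u hut') (fun s hs => eq_of_node_eq hx hs) fun s hs => eq_of_node_eq hy hs
    · intro x y z hxy hxy0 hz
      obtain ⟨α, rfl⟩ := exists_node_eq x
      obtain ⟨β, rfl⟩ := exists_node_eq y
      obtain ⟨γ, rfl⟩ := exists_node_eq z
      have hzy := hz.trans hxy0
      rw [hf, hf] at hxy0 hz hzy
      by_cases h : γ u = α u
      · exact Or.inl (node_eq_of_res_eq_of_eq h₀ hH hz h)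
      · refine Or.inr (node_eq_of_res_eq_of_eq h₀ hH hzy ?_)
        refine eq_of_ne_of_ne hcard hu (hinj α) (hinj γ) (hinj β)
          (fun s hs => (eq_of_node_eq hz hs).symm) (fun s hs => eq_of_node_eq hxy0 hs) h ?_
        exact fun he => hxy.ne (node_eq_of_res_eq_of_eq h₀ hH hxy0 he.symm)
    · intro x y z hxy hxz hyz hlab
      obtain ⟨β, rfl⟩ := exists_node_eq y
      obtain ⟨γ, rfl⟩ := exists_node_eq z
      have hag : ∀ s ∈ insert u T₀, β s = γ s := by
        intro s hs
        have := congrFun hlab ⟨s, hs⟩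
        rwa [csgLabel_node, csgLabel_node] at this
      suffices h : f (node _ β) = f (node _ γ) by
        rw [hf, hf] at h
        exact hyz (node_eq_of_res_eq_of_eq h₀ hH h (hag u hum))
      have hlab0 : csgLabel H₀ k T₀ (f (node _ β)) = csgLabel H₀ k T₀ (f (node _ γ)) := by
        funext s
        rw [hf, hf, csgLabel_node, csgLabel_node]
        exact hag s (hsub s.2)
      rcases hcase _ _ hxy with h1 | h1 <;> rcases hcase _ _ hxz with h2 | h2
      · exact h1.symm.trans h2
      · exact absurd (by rw [h1, hlab0]) (csgLabel_ne_of_adj h2)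
      · exact absurd (by rw [h2, ← hlab0]) (csgLabel_ne_of_adj h1)
      · by_contra hne
        exact hinp _ _ _ h1 h2 hne hlab0

end Introduce

/-! ### Forgetting a terminal adjacent to all others -/

section Forget

variable {V : Type*} [DecidableEq V] {H : SimpleGraph V} {k : ℕ} {T₀ : Finset V} {u : V}

/-- Two colorings of `T₀` that differ at most at `t` use at most `k - 1` colors together, so both
extend to `u` by the same color. -/
theorem exists_injOn_update (hcard : T₀.card + 2 = k) (hu : u ∉ T₀) (L L' : V → Fin k)
    (hL : Set.InjOn L T₀) (hL' : Set.InjOn L' T₀) {t : V}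
    (heq : ∀ s ∈ T₀, s ≠ t → L s = L' s) :
    ∃ c, Set.InjOn (Function.update L u c) (insert u T₀ : Finset V) ∧
      Set.InjOn (Function.update L' u c) (insert u T₀ : Finset V) := by
  obtain ⟨c, hc⟩ : ∃ c, c ∉ insert (L' t) (T₀.image L) := by
    by_contra! h
    have h1 := Finset.card_le_card (fun c _ => h c : Finset.univ ⊆ insert (L' t) (T₀.image L))
    have h2 := Finset.card_insert_le (L' t) (T₀.image L)
    have h3 := Finset.card_image_le (s := T₀) (f := L)
    rw [Finset.card_univ, Fintype.card_fin] at h1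
    omega
  simp only [Finset.mem_insert, Finset.mem_image, not_or, not_exists, not_and] at hc
  have key : ∀ M : V → Fin k, Set.InjOn M T₀ → (∀ s ∈ T₀, M s ≠ c) →
      Set.InjOn (Function.update M u c) (insert u T₀ : Finset V) := by
    intro M hM hMc
    have hupd : Set.EqOn (Function.update M u c) M T₀ := fun s hs =>
      Function.update_of_ne (fun h : s = u => hu (h ▸ hs)) _ _
    rw [Finset.coe_insert, Set.injOn_insert (by simpa using hu)]
    refine ⟨(Set.InjOn.congr hM hupd.symm), ?_⟩
    rintro ⟨s, hs, hsu⟩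
    rw [hupd hs, Function.update_self] at hsu
    exact hMc s hs hsu
  refine ⟨c, key L hL hc.2, key L' hL' fun s hs h => ?_⟩
  by_cases hst : s = t
  · exact hc.1 (hst ▸ h.symm)
  · exact hc.2 s hs ((heq s hs hst).trans h)

/-- Forgetting `u` merges nodes joined by a recoloring of `u`. In the forest case, two neighbors of
a merged node with the same label arise from recoloring the same vertex to the same color, which
fixes the color of `u`, so both come from neighbors of the same unmerged node. -/
theorem forget_outcome (hT : H.IsClique ((insert u T₀ : Finset V) : Set V)) (hu : u ∉ T₀)
    (hcard : T₀.card + 2 = k)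
    (o : IsUnobstructed H k (insert u T₀) ∨ IsForestINP H k (insert u T₀)) :
    IsUnobstructed H k T₀ ∨ IsForestINP H k T₀ := by
  have hsub : T₀ ⊆ insert u T₀ := Finset.subset_insert u T₀
  have hum : u ∈ insert u T₀ := Finset.mem_insert_self u T₀
  have hinj := fun α : H.Coloring (Fin k) => injOn_of_isClique hT α
  let f : CSGNode H k (insert u T₀) → CSGNode H k T₀ := resNode le_rfl (insert u T₀) T₀
  have hf : ∀ α : H.Coloring (Fin k), f (node _ α) = node T₀ α := resNode_node le_rfl hsub
  rcases o with o | ⟨hac, hinp⟩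
  · left
    have hupd : ∀ (L : V → Fin k) (c : Fin k), ∀ s ∈ T₀, Function.update L u c s = L s :=
      fun L c s hs => Function.update_of_ne (fun h : s = u => hu (h ▸ hs)) _ _
    refine ⟨fun L hL => ?_, fun α β h => ?_, fun L L' hL hL' t ht hne heq => ?_⟩
    · obtain ⟨c, hc, -⟩ := exists_injOn_update hcard hu L L hL hL (t := u) fun _ _ _ => rfl
      obtain ⟨α, hα⟩ := o.exists_coloring _ hc
      exact ⟨α, fun t ht => (hα t (hsub ht)).trans (hupd L c t ht)⟩
    · by_cases huα : α u = β u
      · have := o.node_eq α β fun t ht => (Finset.mem_insert.1 ht).elim (fun e => e ▸ huα) (h t)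
        rw [← hf, ← hf, this]
      · have hα := hinj α
        have hβ := hinj β
        obtain ⟨α', β', hα', hβ', hdiff⟩ := o.exists_step α β hα hβ u hum huα
          fun s hs hsu => h s ((Finset.mem_insert.1 hs).resolve_left hsu)
        rw [← hf, ← hf, ← o.node_eq _ _ hα', ← o.node_eq _ _ hβ', hf, hf]
        exact node_eq_of_tStep ⟨u, hu, hdiff⟩
    · obtain ⟨c, hc, hc'⟩ := exists_injOn_update hcard hu L L' hL hL' heq
      have htu : t ≠ u := fun h => hu (h ▸ ht)
      obtain ⟨α, β, hα, hβ, hdiff⟩ := o.exists_step _ _ hc hc' t (hsub ht)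
        (by rwa [hupd L c t ht, hupd L' c t ht]) (by
          intro s hs hst
          by_cases hsu : s = u
          · rw [hsu, Function.update_self, Function.update_self]
          · have hs0 := (Finset.mem_insert.1 hs).resolve_left hsu
            rw [hupd L c s hs0, hupd L' c s hs0, heq s hs0 hst])
      exact ⟨α, β, fun s hs => (hα s (hsub hs)).trans (hupd L c s hs),
        fun s hs => (hβ s (hsub hs)).trans (hupd L' c s hs), hdiff⟩
  · right
    -- The nodes merged into one are connected by recolorings of `u`.
    have hfib : ∀ x y, f x = f y →
        Relation.ReflTransGen (fun a b => (csg H k (insert u T₀)).Adj a b ∧ f a = f b) x y := by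
      intro x y hxy
      obtain ⟨α, rfl⟩ := exists_node_eq x
      obtain ⟨β, rfl⟩ := exists_node_eq y
      rw [hf, hf, node_eq_iff] at hxy
      induction hxy with
      | refl => exact Relation.ReflTransGen.refl
      | @tail γ δ _ hstep ih =>
        have hfγ : f (node _ γ) = f (node _ δ) := by
          rw [hf, hf]
          exact node_eq_of_tStep hstep
        obtain ⟨v, hv, hdiff⟩ := hstep
        by_cases hγδ : γ v = δ v ∨ v ≠ u
        · have he : node (insert u T₀) γ = node (insert u T₀) δ := by
            by_cases hvu : v = u
            · have hvδ := hγδ.resolve_right (not_not.2 hvu)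
              congr 1
              ext w
              by_cases hw : w = v
              · rw [hw, hvδ]
              · rw [hdiff w hw]
            · exact node_eq_of_tStep ⟨v, fun h => (Finset.mem_insert.1 h).elim hvu hv, hdiff⟩
          rw [← he]
          exact ih
        · push Not at hγδ
          obtain ⟨hne, rfl⟩ := hγδ
          exact ih.tail ⟨csg_adj_of_differ hum hne hdiff, hfγ⟩
    have hlift : ∀ p q, (csg H k T₀).Adj p q →
        ∃ x y, f x = p ∧ f y = q ∧ (csg H k (insert u T₀)).Adj x y := by
      intro p q hpq
      obtain ⟨α, β, rfl, rfl, t, ht, hne, hdiff⟩ := exists_of_csg_adj hpq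
      exact ⟨_, _, hf α, hf β, csg_adj_of_differ (hsub ht) hne hdiff⟩
    refine ⟨isAcyclic_of_contraction hlift hfib hac, ?_⟩
    have hlab : ∀ {α β : H.Coloring (Fin k)}, (∀ s ∈ T₀, α s = β s) → α u = β u →
        csgLabel H k (insert u T₀) (node _ α) = csgLabel H k (insert u T₀) (node _ β) := by
      intro α β h h'
      funext s
      rw [csgLabel_node, csgLabel_node]
      exact (Finset.mem_insert.1 s.2).elim (fun e => by rw [e]; exact h') (h s)
    -- At most two nodes are merged into one, as only two colors are available for `u`.
    have htwo : ∀ x y, f x = f y → y = x ∨ (csg H k (insert u T₀)).Adj x y := by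
      intro x y hxy
      have hr := hfib x y hxy
      clear hxy
      induction hr with
      | refl => exact Or.inl rfl
      | @tail y z hy hyz ih =>
        rcases ih with rfl | hxy
        · exact Or.inr hyz.1
        · refine Or.inl (by_contra fun hne => ?_)
          refine hinp _ _ _ hyz.1 hxy.symm hne ?_
          have hfx : f x = f y := by
            clear hxy hne hyz
            induction hy with
            | refl => rfl
            | tail _ h ih => exact ih.trans h.2
          have hfz := hyz.2
          obtain ⟨α, rfl⟩ := exists_node_eq x
          obtain ⟨β, rfl⟩ := exists_node_eq y
          obtain ⟨γ, rfl⟩ := exists_node_eq z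
          rw [hf, hf] at hfx hfz
          have h1 : ∀ s ∈ T₀, β s = α s := fun s hs => (eq_of_node_eq hfx hs).symm
          have h2 : ∀ s ∈ T₀, β s = γ s := fun s hs => eq_of_node_eq hfz hs
          refine hlab (fun s hs => (h2 s hs).symm.trans (h1 s hs)) ?_
          refine eq_of_ne_of_ne hcard hu (hinj β) (hinj γ) (hinj α) h2 h1 ?_ ?_
          · exact fun h => csgLabel_ne_of_adj hyz.1 (hlab h2 h.symm)
          · exact fun h => csgLabel_ne_of_adj hxy (hlab (fun s hs => (h1 s hs).symm) h)
    intro p q q' hpq hpq' hne hlabel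
    obtain ⟨α, β, hα, rfl, t, ht, hαβ, hdiff⟩ := exists_of_csg_adj hpq
    obtain ⟨α', β', hα', rfl, t', ht', hαβ', hdiff'⟩ := exists_of_csg_adj hpq'
    have hp := hα.trans hα'.symm
    have hutt : u ≠ t' := fun h => hu (h ▸ ht')
    have hβ : ∀ s ∈ T₀, β s = β' s := by
      intro s hs
      have := congrFun hlabel ⟨s, hs⟩
      rwa [csgLabel_node, csgLabel_node] at this
    have hα0 : ∀ s ∈ T₀, α s = α' s := fun s hs => eq_of_node_eq hp hs
    have huα : α u = α' u := eq_of_recoloring hcard hu (hinj α) (hinj β) (hinj α') (hinj β') ht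
      hαβ hdiff (hdiff' u hutt) hα0 hβ
    have huβ : β u = β' u := by
      rw [← hdiff u fun h => hu (h ▸ ht), huα, hdiff' u hutt]
    have hx : node (insert u T₀) α' = node (insert u T₀) α := by
      refine (htwo (node _ α) (node _ α') (by rw [hf, hf, hp])).resolve_right fun h => ?_
      exact csgLabel_ne_of_adj h (hlab hα0 huα)
    have h1 := csg_adj_of_differ (hsub ht) hαβ hdiff
    have h2 := csg_adj_of_differ (hsub ht') hαβ' hdiff'
    rw [hx] at h2
    have hy : node (insert u T₀) β = node (insert u T₀) β' :=
      by_contra fun h => hinp _ _ _ h1 h2 h (hlab hβ huβ)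
    exact hne (by rw [← hf, ← hf, hy])

end Forget

/-! ### Decomposition of chordal graphs along the terminals -/

section Decomposition

variable {V : Type*} {G : SimpleGraph V}

/-- No set of fewer than `r` vertices separates two vertices of `A` inside `A`. -/
def NoSmallCut (G : SimpleGraph V) (r : ℕ) (A : Set V) : Prop :=
  ∀ S : Finset V, S.card < r → ∀ x ∈ A \ (S : Set V), ∀ y ∈ A \ (S : Set V),
    (within G (A \ (S : Set V))).Reachable x y

theorem within_mono {A B : Set V} (h : A ⊆ B) : within G A ≤ within G B :=
  fun _ _ hxy => ⟨hxy.1, h hxy.2.1, h hxy.2.2⟩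

/-- Walks that leave `B` do so at the clique `T`, so they can be shortcut within `B`. -/
theorem NoSmallCut.subset {r : ℕ} {A B : Set V} {T : Finset V} (h : NoSmallCut G r A)
    (hBA : B ⊆ A) (hTB : (T : Set V) ⊆ B) (hT : G.IsClique (T : Set V)) (hr : r ≤ T.card)
    (hclosed : ∀ x ∈ B, x ∉ T → ∀ y ∈ A, G.Adj x y → y ∈ B) : NoSmallCut G r B := by
  intro S hS
  obtain ⟨t, htT, htS⟩ : ∃ t ∈ T, t ∉ S := by
    by_contra! hno
    have := Finset.card_le_card hno
    omega
  have key : ∀ x ∈ B \ (S : Set V), (within G (B \ (S : Set V))).Reachable x t := by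
    intro x hx
    have hxt := h S hS x ⟨hBA hx.1, hx.2⟩ t ⟨hBA (hTB htT), htS⟩
    rw [reachable_iff_reflTransGen] at hxt
    induction hxt using Relation.ReflTransGen.head_induction_on with
    | refl => exact Reachable.refl _
    | @head x y hxy _ ih =>
      by_cases hxT : x ∈ T
      · by_cases hxt : x = t
        · rw [hxt]
        · exact Adj.reachable ⟨hT hxT htT hxt, hx, hTB htT, htS⟩
      · have hy : y ∈ B \ (S : Set V) := ⟨hclosed x hx.1 hxT y hxy.2.2.1 hxy.1, hxy.2.2.2⟩
        exact (Adj.reachable (show (within G (B \ (S : Set V))).Adj x y from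
          ⟨hxy.1, hx, hy⟩)).trans (ih hy)
  exact fun x hx y hy => (key x hx).trans (key y hy).symm

theorem isClique_within {A : Set V} {T : Finset V} (hT : G.IsClique (T : Set V))
    (hTA : (T : Set V) ⊆ A) : (within G A).IsClique (T : Set V) :=
  fun _ hs _ ht hst => ⟨hT hs ht hst, hTA hs, hTA ht⟩

/-- The dichotomy for the part of `G` on `A`, by induction on `A` and on the number of vertices of
`A` outside `T`. If `T` separates `A`, the parts are glued. Otherwise, either some vertex of `T`
has no neighbour outside `T`, and is introduced after the rest has been treated, or some vertex
outside `T` is adjacent to all of `T`, and is first added to `T` and then forgotten. -/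
theorem outcome_within [Finite V] (hG : IsChordal G) {k : ℕ}
    (hk : ∀ K : Finset V, G.IsClique (K : Set V) → K.card ≤ k) (n : ℕ) :
    ∀ A T : Finset V, 2 * A.card - T.card ≤ n → T ⊆ A → G.IsClique (T : Set V) →
      k ≤ T.card + 2 → NoSmallCut G (k - 2) A →
      IsUnobstructed (within G A) k T ∨ IsForestINP (within G A) k T := by
  classical
  induction n with
  | zero =>
    intro A T hn hTA _ _ _
    have h := Finset.card_le_card hTA
    have hA : A = ∅ := Finset.card_eq_zero.1 (by omega)
    refine Or.inl (isUnobstructed_of_forall_mem fun u v huv => ?_)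
    rw [hA] at huv
    simpa using huv.2.1
  | succ n ih =>
    intro A T hn hTA hT hkT hcut
    have hcardTA := Finset.card_le_card hTA
    by_cases hAT : A ⊆ T
    · exact Or.inl (isUnobstructed_of_forall_mem fun u v huv => ⟨hAT huv.2.1, hAT huv.2.2⟩)
    obtain ⟨a, haA, haT⟩ := Finset.not_subset.1 hAT
    have hTcl := isClique_within (A := (A : Set V)) hT (Finset.coe_subset.2 hTA)
    have hTk := hk T hT
    have hlt : T.card < A.card :=
      Finset.card_lt_card ((Finset.ssubset_iff_of_subset hTA).2 ⟨a, haA, haT⟩)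
    by_cases hTk' : T.card = k
    · exact Or.inr (isForestINP_of_subset_clique hTcl hTk' subset_rfl)
    let B : Set V := (A : Set V) \ (T : Set V)
    by_cases hconn : ∀ x ∈ B, ∀ y ∈ B, (within G B).Reachable x y
    swap
    · -- `T` separates `x` from `y` in `A`
      push Not at hconn
      obtain ⟨x, hx, y, hy, hxy⟩ := hconn
      let C : Finset V := A.filter fun z => (within G B).Reachable x z
      have hCB : ∀ z ∈ C, z ∉ T := fun z hz =>
        (mem_of_within_reachable (Finset.mem_filter.1 hz).2 hx).2
      have hxC : x ∈ C := Finset.mem_filter.2 ⟨hx.1, Reachable.refl _⟩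
      have hyC : y ∉ C := fun h => hxy (Finset.mem_filter.1 h).2
      have hC : ∀ u v, u ∈ C → v ∈ A → v ∉ T → G.Adj u v → v ∈ C := by
        intro u v hu hv hvT huv
        refine Finset.mem_filter.2 ⟨hv, (Finset.mem_filter.1 hu).2.trans (Adj.reachable ?_)⟩
        exact ⟨huv, ⟨(Finset.mem_filter.1 hu).1, hCB u hu⟩, hv, hvT⟩
      let A₁ := T ∪ C
      let A₂ := A \ C
      have hA₁ : A₁ ⊆ A := Finset.union_subset hTA (Finset.filter_subset _ _)
      have hA₂ : A₂ ⊆ A := Finset.sdiff_subset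
      have hT₁ : T ⊆ A₁ := Finset.subset_union_left
      have hT₂ : T ⊆ A₂ := fun t ht => Finset.mem_sdiff.2 ⟨hTA ht, fun h => hCB t h ht⟩
      have hlt₁ : A₁.card < A.card := by
        refine Finset.card_lt_card ((Finset.ssubset_iff_of_subset hA₁).2 ⟨y, hy.1, fun h => ?_⟩)
        exact (Finset.mem_union.1 h).elim hy.2 hyC
      have hlt₂ : A₂.card < A.card := by
        refine Finset.card_lt_card ((Finset.ssubset_iff_of_subset hA₂).2 ⟨x, hx.1, fun h => ?_⟩)
        exact (Finset.mem_sdiff.1 h).2 hxC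
      have hr : k - 2 ≤ T.card := by omega
      have o₁ := ih A₁ T (by omega) hT₁ hT hkT (hcut.subset (Finset.coe_subset.2 hA₁)
        (Finset.coe_subset.2 hT₁) hT hr fun u hu huT v hv huv => by
          by_cases hvT : v ∈ T
          · exact hT₁ hvT
          · exact Finset.mem_union_right _
              (hC u v ((Finset.mem_union.1 hu).resolve_left huT) hv hvT huv))
      have o₂ := ih A₂ T (by omega) hT₂ hT hkT (hcut.subset (Finset.coe_subset.2 hA₂)
        (Finset.coe_subset.2 hT₂) hT hr fun u hu huT v hv huv => by
          refine Finset.mem_sdiff.2 ⟨hv, fun hvC => ?_⟩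
          obtain ⟨huA, huC⟩ := Finset.mem_sdiff.1 hu
          exact huC (hC v u hvC huA huT huv.symm))
      refine join_outcome (A := (A₁ : Set V)) (within_mono (Finset.coe_subset.2 hA₁))
        (within_mono (Finset.coe_subset.2 hA₂)) (Finset.coe_subset.2 hT₁) ?_ o₁ o₂
      rintro u v ⟨huv, hu, hv⟩
      by_cases h : u ∈ A₁ ∧ v ∈ A₁
      · exact Or.inl ⟨⟨huv, h.1, h.2⟩, h.1, h.2⟩
      · -- Otherwise neither end lies in `C`.
        have hu' : u ∉ C := fun huC => h ⟨Finset.mem_union_right _ huC, by_contra fun hv' =>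
          hv' (Finset.mem_union_right _ (hC u v huC hv (fun hvT => hv' (hT₁ hvT)) huv))⟩
        have hv' : v ∉ C := fun hvC => h ⟨by_contra fun hu' =>
          hu' (Finset.mem_union_right _ (hC v u hvC hu (fun huT => hu' (hT₁ huT)) huv.symm)),
          Finset.mem_union_right _ hvC⟩
        have hmem : ∀ w, w ∉ C → w ∈ (A₁ : Set V)ᶜ ∪ (T : Set V) := by
          intro w hw
          by_cases hwT : w ∈ T
          · exact Or.inr hwT
          · exact Or.inl fun h => (Finset.mem_union.1 h).elim hwT hw
        exact Or.inr ⟨⟨huv, Finset.mem_sdiff.2 ⟨hu, hu'⟩, Finset.mem_sdiff.2 ⟨hv, hv'⟩⟩,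
          hmem u hu', hmem v hv'⟩
    by_cases hnbr : ∀ t ∈ T, ∃ b ∈ B, G.Adj t b
    · -- A vertex adjacent to all of `T` is added to `T`.
      obtain ⟨v, hvB, hv⟩ := hG.exists_adj_clique T hT B ⟨a, haA, haT⟩ (fun t ht h => h.2 ht)
        hconn hnbr
      have hvT : v ∉ T := hvB.2
      have hclique : G.IsClique ((insert v T : Finset V) : Set V) := by
        rw [Finset.coe_insert]
        exact hT.insert fun t ht _ => hv t ht
      have hsub : insert v T ⊆ A := Finset.insert_subset hvB.1 hTA
      have hcl := isClique_within (A := (A : Set V)) hclique (Finset.coe_subset.2 hsub)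
      have hc := Finset.card_insert_of_notMem hvT
      by_cases h2 : T.card + 2 = k
      · exact forget_outcome hcl hvT h2
          (ih A (insert v T) (by omega) hsub hclique (by omega) hcut)
      · exact Or.inr (isForestINP_of_subset_clique hcl (by omega) (Finset.subset_insert v T))
    · -- Some `u` in `T` has no neighbour outside `T`, so that `T \ {u}` is a cut.
      push Not at hnbr
      obtain ⟨u, huT, hu⟩ := hnbr
      have hua : ¬ (within G ((A : Set V) \ (T.erase u : Finset V))).Reachable u a := by
        intro h
        rw [reachable_iff_reflTransGen] at h
        rcases Relation.ReflTransGen.cases_head h with h | ⟨b, hb, -⟩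
        · exact haT (h ▸ huT)
        · refine hu b ⟨hb.2.2.1, fun hbT => hb.2.2.2 ?_⟩ hb.1
          exact Finset.mem_coe.2 (Finset.mem_erase.2 ⟨hb.1.ne.symm, hbT⟩)
      have hc := Finset.card_erase_add_one huT
      have hk2 : k - 2 ≤ (T.erase u).card := by
        by_contra hlt
        refine hua (hcut _ (not_le.1 hlt) u ⟨hTA huT, by simp⟩ a ⟨haA, ?_⟩)
        exact fun h => haT (Finset.mem_of_mem_erase h)
      have huA := Finset.card_erase_add_one (hTA huT)
      have hT₀ : T.erase u ⊆ A.erase u := Finset.erase_subset_erase u hTA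
      have hcl₀ : G.IsClique ((T.erase u : Finset V) : Set V) :=
        hT.subset (Finset.coe_subset.2 (Finset.erase_subset u T))
      have o := ih (A.erase u) (T.erase u) (by omega) hT₀ hcl₀ (by omega)
        (hcut.subset (Finset.coe_subset.2 (Finset.erase_subset u A)) (Finset.coe_subset.2 hT₀)
          hcl₀ hk2 fun x hx hxT y hy hxy => by
            have hx' := Finset.mem_erase.1 hx
            refine Finset.mem_erase.2 ⟨fun h => hu x ⟨hx'.2, fun h' => hxT ?_⟩ (h ▸ hxy.symm), hy⟩
            exact Finset.mem_erase.2 ⟨hx'.1, h'⟩)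
      have hins := Finset.insert_erase huT
      have := introduce_outcome (H := within G (A : Set V)) (u := u)
        (within_mono (Finset.coe_subset.2 (Finset.erase_subset u A))) ?_ (by rwa [hins])
        (Finset.notMem_erase u T) (by omega) o
      · rwa [hins] at this
      rintro x y ⟨hxy, hx, hy⟩
      rw [hins]
      -- An edge at `u` ends in `T`.
      have hend : ∀ z, z ∈ A → G.Adj u z → z ∈ T := fun z hz huz =>
        by_contra fun hzT => hu z ⟨hz, hzT⟩ huz
      by_cases hxu : x = u
      · exact Or.inr ⟨hxu ▸ huT, hend y hy (hxu ▸ hxy)⟩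
      · by_cases hyu : y = u
        · exact Or.inr ⟨hend x hx (hyu ▸ hxy.symm), hyu ▸ huT⟩
        · exact Or.inl ⟨⟨hxy, Finset.mem_coe.2 (Finset.mem_erase.2 ⟨hxu, hx⟩),
            Finset.mem_coe.2 (Finset.mem_erase.2 ⟨hyu, hy⟩)⟩, hxu, hyu⟩

end Decomposition

end ContractedSolutionGraph

theorem mainTheorem2 {V : Type*} [Fintype V] (G : SimpleGraph V) (k : ℕ) (hk : 3 ≤ k)
    (hconn : ContractedSolutionGraph.IsVertexConnected G (k - 2))
    (hcol : G.Colorable k)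
    (hchordal : ContractedSolutionGraph.IsChordal G)
    (T : Finset V) (hT : G.IsClique (T : Set V)) (m : ℕ) (hm : m = T.card) (hmk : k - 2 ≤ m) :
    ContractedSolutionGraph.IsColorComplete m k
        (ContractedSolutionGraph.csg G k T) (ContractedSolutionGraph.csgLabel G k T) ∨
      ((ContractedSolutionGraph.csg G k T).IsAcyclic ∧
        ContractedSolutionGraph.InjectiveNeighborhood
          (ContractedSolutionGraph.csg G k T) (ContractedSolutionGraph.csgLabel G k T)) := by
  open ContractedSolutionGraph in
  subst hm
  have hcl : ∀ K : Finset V, G.IsClique (K : Set V) → K.card ≤ k :=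
    fun K hK => hK.card_le_of_colorable hcol
  have hcut : NoSmallCut G (k - 2) ((Finset.univ : Finset V) : Set V) := by
    intro S hS x hx y hy
    have hpre : (G.induce {v | v ∉ S}).Preconnected :=
      by_contra fun h => absurd (hconn.le_card_of_cut S h) (not_le.2 hS)
    have := within_reachable_of_preconnected hpre (x := x) (y := y) hx.2 hy.2
    exact this.mono (within_mono fun v hv => ⟨Finset.mem_coe.2 (Finset.mem_univ v), hv⟩)
  have h := outcome_within hchordal hcl _ Finset.univ T le_rfl (Finset.subset_univ T) hT
    (by omega) hcut
  rw [Finset.coe_univ, within_univ] at h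
  exact h.imp (fun h => h.isColorComplete hT (by omega) (hcl T hT)) id
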